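/- Let $m\ge 1$ be an integer and $\delta>-m$ a real number. For $\varepsilon>-1$ define the random directed multigraph $G_n^{1,\varepsilon}$ on the vertices $1,\dots,n$ recursively. $G_1^{1,\varepsilon}$ is one vertex with a single loop. For $k\ge2$, given $G_{k-1}^{1,\varepsilon}$, add the vertex $k$ together with one edge going out of $k$ and into a random vertex of $\{1,\dots,k\}$, chosen with probability proportional to the total degree of that vertex plus $\varepsilon$, where vertex $k$ initially has degree one (from its out-edge) and a loop contributes one to the in-degree and one to the out-degree. The random multigraph $G_n^{m,\delta}$ is obtained from $G_{nm}^{1,\delta/m}$ by collapsing, for each $i=1,\dots,n$, the vertices $m(i-1)+1,\dots,mi$ into the single vertex $i$, retaining all edges (including loops and multiple edges). For $1\le i\le n$ let $W_{n,i}$ be the in-degree of vertex $i$ in $G_n^{m,\delta}$ and $\mu_{n,i}=\mathbb{E}W_{n,i}$. For $r>0$ and $0<p\le1$ let $\mathrm{NB}(r,p)$ be the distribution on $\{0,1,2,\dots\}$ giving mass $\frac{\Gamma(r+k)}{k!\,\Gamma(r)}(1-p)^kp^r$ to $k$, and for probability distributions $P,Q$ on $\{0,1,2,\dots\}$ let $d_{\mathrm{TV}}(P,Q)=\sup_{A\subseteq\{0,1,2,\dots\}}|P(A)-Q(A)|$.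 Then there is a constant $C_{m,\delta}$, depending only on $m$ and $\delta$, such that for all integers $1\le i\le n$, $$d_{\mathrm{TV}}\Bigl(\mathcal{L}(W_{n,i}),\ \mathrm{NB}\bigl(m+\delta,\tfrac{m+\delta}{\mu_{n,i}+m+\delta}\bigr)\Bigr)\le\frac{C_{m,\delta}}{i}.$$ -/

import Mathlib

open MeasureTheory
open scoped ENNReal

noncomputable section

/-- A directed multigraph with vertices `V` and edges `E` (loops and multiple edges are
allowed): the edge `e` goes out of `src e` and into `tgt e`. -/
structure DiMultigraph (V E : Type) where
  src : E → V
  tgt : E → V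

namespace DiMultigraph

/-- The number of edges into `v`; a loop at `v` counts once. -/
def inDegree {V E : Type} [Fintype E] [DecidableEq V] (G : DiMultigraph V E) (v : V) : ℕ :=
  (Finset.univ.filter fun e => G.tgt e = v).card

/-- The number of edges out of `v`; a loop at `v` counts once. -/
def outDegree {V E : Type} [Fintype E] [DecidableEq V] (G : DiMultigraph V E) (v : V) : ℕ :=
  (Finset.univ.filter fun e => G.src e = v).card

/-- The total degree of `v`; a loop at `v` counts twice. -/
def degree {V E : Type} [Fintype E] [DecidableEq V] (G : DiMultigraph V E) (v : V) : ℕ :=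
  G.inDegree v + G.outDegree v

/-- Identify vertices along `f`, retaining all edges. -/
def collapse {V V' E : Type} (G : DiMultigraph V E) (f : V → V') : DiMultigraph V' E where
  src := f ∘ G.src
  tgt := f ∘ G.tgt

/-- Add a new vertex (the last one) and a new edge from it to `t`, which is either an old vertex
or the new vertex itself. -/
def addVertex {k : ℕ} (G : DiMultigraph (Fin k) (Fin k)) (t : Fin (k + 1)) :
    DiMultigraph (Fin (k + 1)) (Fin (k + 1)) where
  src := Fin.snoc (α := fun _ => Fin (k + 1)) (fun e => (G.src e).castSucc) (Fin.last k)
  tgt := Fin.snoc (α := fun _ => Fin (k + 1)) (fun e => (G.tgt e).castSucc) t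

/-- The weight with which the edge out of the new vertex chooses its end: total degree plus `δ`
for an old vertex; the new vertex initially has degree one. -/
def attachWeight {k : ℕ} (δ : ℝ) (G : DiMultigraph (Fin k) (Fin k)) : Fin (k + 1) → ℝ :=
  Fin.snoc (α := fun _ => ℝ) (fun v => (G.degree v : ℝ) + δ) (1 + δ)

theorem tsum_attachWeight_ne_zero {k : ℕ} {δ : ℝ} (hδ : -1 < δ)
    (G : DiMultigraph (Fin k) (Fin k)) :
    ∑' t, ENNReal.ofReal (G.attachWeight δ t) ≠ 0 := by
  intro h
  have h1 := ENNReal.tsum_eq_zero.mp h (Fin.last k)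
  simp only [attachWeight, Fin.snoc_last, ENNReal.ofReal_eq_zero] at h1
  linarith

theorem tsum_attachWeight_ne_top {k : ℕ} {δ : ℝ} (G : DiMultigraph (Fin k) (Fin k)) :
    ∑' t, ENNReal.ofReal (G.attachWeight δ t) ≠ ∞ := by
  rw [tsum_fintype]
  exact ENNReal.sum_ne_top.mpr fun _ _ => ENNReal.ofReal_ne_top

/-- The random end of the new edge: vertex `t` with probability proportional to its weight.
(Every vertex of a graph that occurs in the model has degree at least one, so that all the
weights are positive there.) -/
def attachPMF {k : ℕ} (δ : ℝ) (hδ : -1 < δ) (G : DiMultigraph (Fin k) (Fin k)) :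
    PMF (Fin (k + 1)) :=
  PMF.normalize (fun t => ENNReal.ofReal (G.attachWeight δ t))
    (G.tsum_attachWeight_ne_zero hδ) G.tsum_attachWeight_ne_top

end DiMultigraph

/-- The preferential attachment graph with one edge per vertex, after `n` steps. Vertices are
numbered from `0`. The first step, from the empty graph, necessarily produces one vertex with a
single loop. -/
def prefAttachOne (δ : ℝ) (hδ : -1 < δ) : (n : ℕ) → PMF (DiMultigraph (Fin n) (Fin n))
  | 0 => PMF.pure ⟨id, id⟩
  | k + 1 => (prefAttachOne δ hδ k).bind fun G => (G.attachPMF δ hδ).map G.addVertex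

theorem neg_one_lt_div_of_neg_lt {m : ℕ} {δ : ℝ} (hδ : -(m : ℝ) < δ) : -1 < δ / m := by
  rcases Nat.eq_zero_or_pos m with h | h
  · subst h; simp
  · rw [lt_div_iff₀ (by exact_mod_cast h)]; linarith

/-- The preferential attachment graph with `n` vertices and `m` edges per vertex: generate the
graph with one edge per vertex, `n * m` vertices and parameter `δ / m`, and collapse consecutive
vertices into groups of size `m` (vertex `j`, numbered from `0`, goes to the group `j / m`). -/
def prefAttach (m : ℕ) (δ : ℝ) (hδ : -(m : ℝ) < δ) (n : ℕ) :
    PMF (DiMultigraph (Fin n) (Fin (n * m))) :=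
  (prefAttachOne (δ / m) (neg_one_lt_div_of_neg_lt hδ) (n * m)).map
    fun G => G.collapse Fin.divNat

/-- The law of the in-degree of the vertex `i` of the preferential attachment graph. -/
def inDegreeLaw (m : ℕ) (δ : ℝ) (hδ : -(m : ℝ) < δ) (n : ℕ) (i : Fin n) : Measure ℕ :=
  ((prefAttach m δ hδ n).map fun G => G.inDegree i).toMeasure

/-- The expected in-degree of the vertex `i` of the preferential attachment graph. -/
def meanInDegree (m : ℕ) (δ : ℝ) (hδ : -(m : ℝ) < δ) (n : ℕ) (i : Fin n) : ℝ :=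
  ∫ w, (w : ℝ) ∂(inDegreeLaw m δ hδ n i)

/-- The negative binomial distribution, for `0 < r` and `0 < p ≤ 1`. -/
def negBinomial (r p : ℝ) : Measure ℕ :=
  Measure.sum fun k : ℕ =>
    ENNReal.ofReal (Real.Gamma (r + k) / (k.factorial * Real.Gamma r) * (1 - p) ^ k * p ^ r) •
      Measure.dirac k

/-- The total variation distance between probability measures on the non-negative integers. -/
def tvDist (P Q : Measure ℕ) : ℝ := ⨆ A : Set ℕ, |P.real A - Q.real A|

end

/-!
# Negative binomial approximation of degrees in preferential attachment graphs

Write `ε = δ / m`, `α = 1 / (2 + ε)` and `r = m + δ`. The in-degree `X` of a group of `m`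
consecutive vertices is a Markov chain with steps zero and one (`groupExp_succ`): once the group is
complete, and the graph has `k` vertices, it grows with probability `l_k (X + r)`, where `l_k` is
the reciprocal of the total weight (`attachRate`). So its transition operator is `1 + l_k L`, where
`L f x = (x + r) (f (x + 1) - f x)` is the generator of a Yule process with immigration. The law of
that process at the time `log z`, started from zero, is exactly negative binomial with parameters
`r` and `1 / z`; hence it suffices to replace each `1 + l_k L` by `exp (log (1 + l_k) L)`, which
has the same effect on the mean.

Let `v z x` be the expectation of a test function `f` with values in `[0, 1]` at the time `log z`
when the process starts from `x` (`nbValue`), and let `a = x + r`. Then `z ∂v/∂z = L v`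
(`hasDerivAt_nbExp`), so that one replacement costs at most `l_k ^ 2` times the supremum of
`z ^ 2 ∂²v/∂z² = a (a + 1) (v (x + 2) - 2 v (x + 1) + v x)`
(`abs_nbExp_mul_one_add_sub_le`). This quantity is at most `2 a (a + 1)`, trivially, and at most
`6 a z / (z - 1)`, by the smoothness of the negative binomial laws (`mul_abs_nbSecondDiff_le`).
After rescaling `i` and `n` by `m`, the mean of `a` is at most of order `(k / i) ^ α`, its second
moment at most of order `(k / i) ^ (2 α)`, and `z - 1`, where `z` is the growth factor over the
steps that remain (`growth`), is at least of order `(n - k) / n`. So the sum of all the errors is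
of order `1 / i` (`exists_sum_min_le`); here `α < 1` is essential.

What remains is the effect of the `m` steps during which the group is built. The mean in-degree of
the group at the end of them is of order `1 / i` (`exists_groupExp_cast_le`), and so is, therefore,
the effect of starting the process from zero at that time, as well as the effect of the resulting
relative change in `z` (`abs_nbExp_sub_nbExp_le`).
-/

noncomputable section

/-! ### The negative binomial family -/

/-- The coefficient `Γ(a + k) / (k! Γ(a))` of `q ^ k` in the expansion of `(1 - q) ^ (-a)`. -/
def nbCoeff (a : ℝ) (k : ℕ) : ℝ := Real.Gamma (a + k) / (k.factorial * Real.Gamma a)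

lemma nbCoeff_zero {a : ℝ} (ha : 0 < a) : nbCoeff a 0 = 1 := by
  simp [nbCoeff, (Real.Gamma_pos_of_pos ha).ne']

lemma nbCoeff_nonneg {a : ℝ} (ha : 0 < a) (k : ℕ) : 0 ≤ nbCoeff a k := by
  have h1 := Real.Gamma_pos_of_pos ha
  have h2 : 0 < Real.Gamma (a + k) := Real.Gamma_pos_of_pos (by positivity)
  unfold nbCoeff
  positivity

lemma succ_mul_nbCoeff_succ {a : ℝ} (ha : 0 < a) (k : ℕ) :
    ((k : ℝ) + 1) * nbCoeff a (k + 1) = (a + k) * nbCoeff a k := by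
  have h1 := (Real.Gamma_pos_of_pos ha).ne'
  have h2 : Real.Gamma (a + (k + 1 : ℕ)) = (a + k) * Real.Gamma (a + k) := by
    rw [← Real.Gamma_add_one (by positivity)]
    push_cast
    ring_nf
  have h3 : ((k.factorial : ℕ) : ℝ) ≠ 0 := by positivity
  unfold nbCoeff
  rw [h2, Nat.factorial_succ]
  push_cast
  field_simp

lemma succ_mul_nbCoeff_succ_eq_mul {a : ℝ} (ha : 0 < a) (k : ℕ) :
    ((k : ℝ) + 1) * nbCoeff a (k + 1) = a * nbCoeff (a + 1) k := by
  have h1 := (Real.Gamma_pos_of_pos ha).ne'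
  have h3 : ((k.factorial : ℕ) : ℝ) ≠ 0 := by positivity
  unfold nbCoeff
  rw [Real.Gamma_add_one ha.ne', Nat.factorial_succ,
    show a + ((k + 1 : ℕ) : ℝ) = a + 1 + k by push_cast; ring]
  push_cast
  field_simp

lemma nbCoeff_eq_choose {a : ℝ} (ha : 0 < a) (k : ℕ) :
    nbCoeff a k = Ring.choose (a + k - 1) k := by
  have h : Ring.choose (a + k - 1) k = Ring.multichoose a k := by
    rw [Ring.choose]
    congr 1
    ring
  have hk : ∀ k : ℕ, (k.factorial : ℝ) * nbCoeff a k = (ascPochhammer ℝ k).eval a := by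
    intro k
    induction k with
    | zero => simp [nbCoeff_zero ha]
    | succ k ih =>
      rw [ascPochhammer_succ_eval, ← ih, Nat.factorial_succ]
      push_cast
      linear_combination (k.factorial : ℝ) * succ_mul_nbCoeff_succ ha k
  have h2 := Ring.factorial_nsmul_multichoose_eq_ascPochhammer a k
  rw [Polynomial.ascPochhammer_smeval_eq_eval, nsmul_eq_mul, ← hk] at h2
  rw [h]
  exact (mul_left_cancel₀ (by positivity) h2).symm

lemma hasSum_nbCoeff {a q : ℝ} (ha : 0 < a) (hq : |q| < 1) :
    HasSum (fun k => nbCoeff a k * q ^ k) (1 / (1 - q) ^ a) := by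
  have h := (Real.one_div_one_sub_rpow_hasFPowerSeriesOnBall_zero a).hasSum (y := q)
    (by simpa [enorm_eq_nnnorm] using! hq)
  simp only [zero_add] at h
  refine h.congr_fun fun k => ?_
  simp [nbCoeff_eq_choose ha, mul_comm]

lemma summable_nbCoeff {a q : ℝ} (ha : 0 < a) (hq : |q| < 1) :
    Summable (fun k => nbCoeff a k * q ^ k) := (hasSum_nbCoeff ha hq).summable

lemma summable_mul_nbCoeff {a q : ℝ} (ha : 0 < a) (hq : |q| < 1) {f : ℕ → ℝ}
    (hf : ∀ k, |f k| ≤ 1) : Summable (fun k => f k * (nbCoeff a k * q ^ k)) := by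
  refine Summable.of_norm_bounded (summable_nbCoeff ha (q := |q|) (by simpa using hq)) fun k => ?_
  rw [norm_mul, norm_mul, norm_pow, Real.norm_eq_abs, Real.norm_eq_abs, Real.norm_eq_abs,
    abs_of_nonneg (nbCoeff_nonneg ha k)]
  have := nbCoeff_nonneg ha k
  exact mul_le_of_le_one_left (by positivity) (hf k)

lemma hasDerivAt_tsum_nbCoeff {a q : ℝ} (ha : 0 < a) (hq : |q| < 1) {f : ℕ → ℝ}
    (hf : ∀ k, |f k| ≤ 1) :
    HasDerivAt (fun q => ∑' k, f k * (nbCoeff a k * q ^ k))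
      (a * ∑' k, f (k + 1) * (nbCoeff (a + 1) k * q ^ k)) q := by
  obtain ⟨ρ, hqρ, hρ1⟩ := exists_between hq
  have hρ0 : 0 < ρ := (abs_nonneg q).trans_lt hqρ
  have hρ : |ρ| < 1 := by rwa [abs_of_pos hρ0]
  have key : ∀ (k : ℕ) (y : ℝ), f (k + 1) * (nbCoeff a (k + 1) * (((k + 1 : ℕ) : ℝ) * y ^ k)) =
      a * (f (k + 1) * (nbCoeff (a + 1) k * y ^ k)) := by
    intro k y
    push_cast
    linear_combination f (k + 1) * y ^ k * succ_mul_nbCoeff_succ_eq_mul ha k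
  have hu : Summable fun k : ℕ => nbCoeff a k * ((k : ℝ) * ρ ^ (k - 1)) := by
    rw [← summable_nat_add_iff 1]
    refine ((summable_nbCoeff (by linarith : 0 < a + 1) hρ).mul_left a).congr fun k => ?_
    simp only [Nat.add_sub_cancel]
    push_cast
    linear_combination (-ρ ^ k) * succ_mul_nbCoeff_succ_eq_mul ha k
  have h := hasDerivAt_tsum_of_isPreconnected (y₀ := q) (y := q) (t := Set.Ioo (-ρ) ρ)
    (g := fun (k : ℕ) (q : ℝ) => f k * (nbCoeff a k * q ^ k))
    (g' := fun (k : ℕ) (q : ℝ) => f k * (nbCoeff a k * ((k : ℝ) * q ^ (k - 1)))) hu isOpen_Ioo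
    isPreconnected_Ioo
    (fun k y _ => ((hasDerivAt_pow k y).const_mul _).const_mul _)
    (fun k y hy => by
      have hk := nbCoeff_nonneg ha k
      have hy' : |y| ≤ ρ := (abs_lt.mpr hy).le
      rw [Real.norm_eq_abs, abs_mul, abs_mul, abs_mul, abs_pow, abs_of_nonneg hk, Nat.abs_cast]
      refine (mul_le_of_le_one_left (by positivity) (hf k)).trans ?_
      gcongr)
    (abs_lt.mp hqρ) (summable_mul_nbCoeff ha hq hf) (abs_lt.mp hqρ)
  refine h.congr_deriv ?_
  have hs : Summable fun k : ℕ => f k * (nbCoeff a k * ((k : ℝ) * q ^ (k - 1))) := by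
    rw [← summable_nat_add_iff 1]
    refine ((summable_mul_nbCoeff (by linarith : 0 < a + 1) hq
      (f := fun k => f (k + 1)) fun k => hf _).mul_left a).congr fun k => ?_
    rw [Nat.add_sub_cancel, key]
  rw [hs.tsum_eq_zero_add, ← tsum_mul_left]
  simp only [Nat.add_sub_cancel, key]
  simp

/-- The mass at `k` of the negative binomial law with parameters `a` and `1 / z`, which has
mean `a (z - 1)`. -/
def nbMass (a z : ℝ) (k : ℕ) : ℝ := nbCoeff a k * (1 - 1 / z) ^ k * (1 / z) ^ a

/-- The expectation of `f` under the negative binomial law with parameters `a` and `1 / z`. -/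
def nbExp (f : ℕ → ℝ) (a z : ℝ) : ℝ := ∑' k, f k * nbMass a z k

lemma nbMass_nonneg {a z : ℝ} (ha : 0 < a) (hz : 1 ≤ z) (k : ℕ) : 0 ≤ nbMass a z k := by
  have h1 := nbCoeff_nonneg ha k
  have h2 : 0 ≤ 1 - 1 / z := by
    rw [sub_nonneg, div_le_one (by linarith)]
    exact hz
  unfold nbMass
  positivity

lemma abs_one_sub_inv_lt_one {z : ℝ} (hz : 1 / 2 < z) : |1 - 1 / z| < 1 := by
  have hz0 : 0 < z := by linarith
  have h1 : 1 / z < 2 := by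
    rw [div_lt_iff₀ hz0]
    linarith
  have h2 : 0 < 1 / z := by positivity
  rw [abs_lt]
  constructor <;> linarith

lemma hasSum_nbMass {a z : ℝ} (ha : 0 < a) (hz : 1 / 2 < z) : HasSum (nbMass a z) 1 := by
  have hz0 : 0 < z := by linarith
  have h := (hasSum_nbCoeff ha (abs_one_sub_inv_lt_one hz)).mul_right ((1 / z) ^ a)
  have h2 : 0 < (1 / z) ^ a := by positivity
  rwa [show 1 - (1 - 1 / z) = 1 / z by ring, one_div_mul_cancel h2.ne'] at h

lemma summable_mul_nbMass {a z : ℝ} (ha : 0 < a) (hz : 1 / 2 < z) {f : ℕ → ℝ}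
    (hf : ∀ k, |f k| ≤ 1) : Summable (fun k => f k * nbMass a z k) := by
  refine ((summable_mul_nbCoeff ha (abs_one_sub_inv_lt_one hz) hf).mul_right
    ((1 / z) ^ a)).congr fun k => ?_
  unfold nbMass
  ring

lemma hasSum_nbExp {a z : ℝ} (ha : 0 < a) (hz : 1 / 2 < z) {f : ℕ → ℝ}
    (hf : ∀ k, |f k| ≤ 1) : HasSum (fun k => f k * nbMass a z k) (nbExp f a z) :=
  (summable_mul_nbMass ha hz hf).hasSum

lemma nbExp_mem_Icc {a z : ℝ} (ha : 0 < a) (hz : 1 ≤ z) {f : ℕ → ℝ}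
    (hf : ∀ k, f k ∈ Set.Icc (0 : ℝ) 1) : nbExp f a z ∈ Set.Icc (0 : ℝ) 1 := by
  have hf' : ∀ k, |f k| ≤ 1 := fun k => by
    rw [abs_of_nonneg (hf k).1]
    exact (hf k).2
  have h := hasSum_nbExp ha (by linarith : 1 / 2 < z) hf'
  constructor
  · exact h.nonneg fun k => mul_nonneg (hf k).1 (nbMass_nonneg ha hz k)
  · exact hasSum_le (fun k => mul_le_of_le_one_left (nbMass_nonneg ha hz k) (hf k).2) h
      (hasSum_nbMass ha (by linarith))

lemma nbExp_one (f : ℕ → ℝ) {a : ℝ} (ha : 0 < a) : nbExp f a 1 = f 0 := by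
  unfold nbExp
  rw [tsum_eq_single 0]
  · simp [nbMass, nbCoeff_zero ha]
  · intro k hk
    simp [nbMass, hk]

/-- In logarithmic scale `z = exp s` the negative binomial expectations form the semigroup of the
Yule process with immigration, whose generator is `f ↦ a (f (· + 1) - f)`. -/
lemma hasDerivAt_nbExp {a z : ℝ} (ha : 0 < a) (hz : 1 / 2 < z) {f : ℕ → ℝ}
    (hf : ∀ k, |f k| ≤ 1) :
    HasDerivAt (nbExp f a)
      (a / z * (nbExp (fun k => f (k + 1)) (a + 1) z - nbExp f a z)) z := by
  have hz0 : 0 < z := by linarith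
  have hq := abs_one_sub_inv_lt_one hz
  have e : ∀ (g : ℕ → ℝ) (b w : ℝ), nbExp g b w =
      (∑' k, g k * (nbCoeff b k * (1 - 1 / w) ^ k)) * (1 / w) ^ b := by
    intro g b w
    rw [← tsum_mul_right]
    exact tsum_congr fun k => by unfold nbMass; ring
  have d1 : HasDerivAt (fun w : ℝ => 1 / w) (-(1 / z ^ 2)) z := by
    simpa using hasDerivAt_inv hz0.ne'
  have d2 : HasDerivAt (fun w : ℝ => 1 - 1 / w) (1 / z ^ 2) z := by
    simpa using d1.const_sub 1
  have d3 := (hasDerivAt_tsum_nbCoeff ha hq hf).comp z d2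
  have d4 := d1.rpow_const (p := a) (Or.inl (by positivity))
  have d5 := d3.mul d4
  have e' : nbExp f a = fun w => (∑' k, f k * (nbCoeff a k * (1 - 1 / w) ^ k)) * (1 / w) ^ a := by
    funext w
    exact e f a w
  rw [e']
  refine d5.congr_deriv ?_
  rw [e]
  have r1 : (1 / z) ^ (a + 1) = (1 / z) ^ a * (1 / z) := Real.rpow_add_one (by positivity) a
  have r2 : (1 / z) ^ (a - 1) = (1 / z) ^ a * z := by
    rw [Real.rpow_sub_one (by positivity)]
    field_simp
  simp only [Function.comp_apply]
  rw [r1, r2]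
  field_simp
  ring

/-- The size bias identity: weighting by `k` amounts to raising `a` by one and shifting. -/
lemma hasSum_natCast_mul_nbMass {a z s : ℝ} (ha : 0 < a) (hz : 0 < z) {F : ℕ → ℝ}
    (h : HasSum (fun k => F (k + 1) * nbMass (a + 1) z k) s) :
    HasSum (fun k : ℕ => (k : ℝ) * F k * nbMass a z k) (a * (z - 1) * s) := by
  rw [← hasSum_nat_add_iff' 1]
  simp only [Finset.range_one, Finset.sum_singleton, Nat.cast_zero, zero_mul, sub_zero]
  refine (h.mul_left (a * (z - 1))).congr_fun fun k => ?_
  have r1 : (1 / z) ^ (a + 1) = (1 / z) ^ a * (1 / z) := Real.rpow_add_one (by positivity) a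
  unfold nbMass
  rw [r1]
  have := succ_mul_nbCoeff_succ_eq_mul ha k
  have h2 : (z - 1) * (1 / z) = 1 - 1 / z := by field_simp
  push_cast
  rw [pow_succ]
  linear_combination F (k + 1) * (1 - 1 / z) ^ k * (1 - 1 / z) * (1 / z) ^ a * this -
    a * F (k + 1) * nbCoeff (a + 1) k * (1 - 1 / z) ^ k * (1 / z) ^ a * h2

/-! ### Expansion of the semigroup over a short time -/

/-- The second difference of the expectation of `f` in the initial state of the Yule process with
immigration. -/
def nbSecondDiff (f : ℕ → ℝ) (a z : ℝ) : ℝ :=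
  nbExp (fun k => f (k + 2)) (a + 2) z - 2 * nbExp (fun k => f (k + 1)) (a + 1) z + nbExp f a z

lemma abs_le_one_of_mem_Icc {f : ℕ → ℝ} (hf : ∀ k, f k ∈ Set.Icc (0 : ℝ) 1) (k : ℕ) :
    |f k| ≤ 1 := by
  rw [abs_of_nonneg (hf k).1]
  exact (hf k).2

lemma abs_nbSecondDiff_le {a z : ℝ} (ha : 0 < a) (hz : 1 ≤ z) {f : ℕ → ℝ}
    (hf : ∀ k, f k ∈ Set.Icc (0 : ℝ) 1) : |nbSecondDiff f a z| ≤ 2 := by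
  have h0 := nbExp_mem_Icc ha hz hf
  have h1 := nbExp_mem_Icc (by linarith : 0 < a + 1) hz (f := fun k => f (k + 1)) fun k => hf _
  have h2 := nbExp_mem_Icc (by linarith : 0 < a + 2) hz (f := fun k => f (k + 2)) fun k => hf _
  unfold nbSecondDiff
  rw [abs_le]
  constructor <;> linarith [h0.1, h0.2, h1.1, h1.2, h2.1, h2.2]

/-- The regularizing effect of the semigroup. By the size bias identity, `a (a + 1) (z - 1) ^ 2`
times the second difference is the expectation of `f` against the polynomial
`(k - a (z - 1)) ^ 2 - (2 z - 1) (k - a (z - 1)) - a z (z - 1)`, whose absolute value is integrated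
by means of the first two moments. -/
lemma mul_abs_nbSecondDiff_le {a z : ℝ} (ha : 0 < a) (hz : 1 < z) {f : ℕ → ℝ}
    (hf : ∀ k, |f k| ≤ 1) :
    a * (a + 1) * |nbSecondDiff f a z| ≤ 6 * a * (z / (z - 1)) := by
  have hz0 : 0 < z := by linarith
  have hz2 : 1 / 2 < z := by linarith
  have ha1 : 0 < a + 1 := by linarith
  have moments : ∀ g : ℕ → ℝ, (∀ k, |g k| ≤ 1) →
      HasSum (fun k : ℕ => (k : ℝ) * g k * nbMass a z k)
        (a * (z - 1) * nbExp (fun k => g (k + 1)) (a + 1) z) ∧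
      HasSum (fun k : ℕ => (k : ℝ) * (((k : ℝ) - 1) * g k) * nbMass a z k)
        (a * (z - 1) * ((a + 1) * (z - 1) * nbExp (fun k => g (k + 2)) (a + 2) z)) := by
    intro g hg
    refine ⟨hasSum_natCast_mul_nbMass ha hz0 (hasSum_nbExp ha1 hz2 fun k => hg _), ?_⟩
    refine hasSum_natCast_mul_nbMass (F := fun k : ℕ => ((k : ℝ) - 1) * g k) ha hz0 ?_
    have e : a + 1 + 1 = a + 2 := by ring
    have h := hasSum_natCast_mul_nbMass (F := fun k => g (k + 1)) (a := a + 1) ha1 hz0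
      (hasSum_nbExp (f := fun k => g (k + 2)) (by linarith) hz2 fun k => hg _)
    rw [e] at h
    refine h.congr_fun fun k => ?_
    push_cast
    ring
  obtain ⟨m1, m2⟩ := moments f hf
  obtain ⟨c1, c2⟩ := moments (fun _ => 1) (by simp)
  have one : ∀ b : ℝ, 0 < b → nbExp (fun _ => 1) b z = 1 := fun b hb => by
    simpa [nbExp] using (hasSum_nbMass hb hz2).tsum_eq
  rw [one _ ha1] at c1
  rw [one _ (by linarith)] at c2
  have m0 := hasSum_nbExp ha hz2 hf
  have c0 := hasSum_nbMass ha hz2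
  set y := z - 1 with hy
  have hy0 : 0 < y := by linarith
  have hzy : z = 1 + y := by linarith
  have S : HasSum (fun k : ℕ => f k * ((((k : ℝ) - a * y) ^ 2 - (1 + 2 * y) * (k - a * y) -
      a * z * y) * nbMass a z k)) (a * (a + 1) * y ^ 2 * nbSecondDiff f a z) := by
    convert! (m2.sub (m1.mul_left (2 * (a + 1) * y))).add
      (m0.mul_left (a * (a + 1) * y ^ 2)) using 1
    · funext k
      rw [hzy]
      ring
    · unfold nbSecondDiff
      ring
  -- The linear term is bounded by `|k - a y| ≤ k + a y`, which suffices.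
  have B : HasSum (fun k : ℕ => (((k : ℝ) - a * y) ^ 2 + (1 + 2 * y) * (k + a * y) +
      a * z * y) * nbMass a z k) (2 * a * z * y + 2 * a * y * (1 + 2 * y)) := by
    convert! ((c2.add (c1.mul_left (2 + 2 * y - 2 * a * y))).add
      (c0.mul_left (a ^ 2 * y ^ 2 + (1 + 2 * y) * (a * y) + a * z * y))) using 1
    · funext k
      ring
    · rw [hzy]
      ring
  have hle : |a * (a + 1) * y ^ 2 * nbSecondDiff f a z| ≤
      2 * a * z * y + 2 * a * y * (1 + 2 * y) := by
    rw [← S.tsum_eq, ← Real.norm_eq_abs]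
    refine tsum_of_norm_bounded B fun k => ?_
    have hk := nbMass_nonneg ha hz.le k
    rw [Real.norm_eq_abs, abs_mul, abs_mul, abs_of_nonneg hk]
    refine (mul_le_of_le_one_left (by positivity) (hf k)).trans ?_
    refine mul_le_mul_of_nonneg_right ?_ hk
    have h1 : 0 ≤ (1 + 2 * y) * (k : ℝ) := by positivity
    have h2 : 0 ≤ (1 + 2 * y) * (a * y) := by positivity
    have h3 : 0 ≤ a * z * y := by positivity
    have h4 : 0 ≤ ((k : ℝ) - a * y) ^ 2 := by positivity
    rw [abs_le]
    constructor <;> nlinarith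
  rw [abs_mul, abs_of_pos (by positivity : 0 < a * (a + 1) * y ^ 2)] at hle
  rw [← mul_div_assoc, le_div_iff₀ hy0]
  refine le_of_mul_le_mul_right ?_ hy0
  calc a * (a + 1) * |nbSecondDiff f a z| * y * y
      = a * (a + 1) * y ^ 2 * |nbSecondDiff f a z| := by ring
    _ ≤ _ := hle
    _ ≤ 6 * a * z * y := by
      have : 0 < a * y := by positivity
      rw [hzy]
      nlinarith

lemma hasDerivAt_deriv_nbExp {a z : ℝ} (ha : 0 < a) (hz : 1 / 2 < z) {f : ℕ → ℝ}
    (hf : ∀ k, |f k| ≤ 1) :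
    HasDerivAt (fun z => a / z * (nbExp (fun k => f (k + 1)) (a + 1) z - nbExp f a z))
      (a * (a + 1) * nbSecondDiff f a z / z ^ 2) z := by
  have hz0 : z ≠ 0 := by linarith
  have h0 := hasDerivAt_nbExp ha hz hf
  have h1 := hasDerivAt_nbExp (a := a + 1) (by linarith) hz (f := fun k => f (k + 1)) fun k => hf _
  have h2 : HasDerivAt (fun z : ℝ => a / z) (-(a / z ^ 2)) z := by
    simpa [div_eq_mul_inv] using (hasDerivAt_inv hz0).const_mul a
  refine (h2.mul (h1.sub h0)).congr_deriv ?_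
  unfold nbSecondDiff
  rw [show a + 1 + 1 = a + 2 by ring]
  simp only [add_assoc, one_add_one_eq_two, Pi.sub_apply]
  field_simp
  ring

/-- The semigroup over the time `log (1 + l)` agrees with one step of the discrete birth chain
up to second order in `l`. -/
lemma abs_nbExp_mul_one_add_sub_le {a z l M : ℝ} (ha : 0 < a) (hz : 1 ≤ z) (hl : 0 ≤ l)
    {f : ℕ → ℝ} (hf : ∀ k, |f k| ≤ 1)
    (hM : ∀ w, z ≤ w → a * (a + 1) * |nbSecondDiff f a w| ≤ M) :
    |nbExp f a (z * (1 + l)) -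
      (nbExp f a z + l * (a * (nbExp (fun k => f (k + 1)) (a + 1) z - nbExp f a z)))| ≤
      l ^ 2 * M := by
  have hz0 : 0 < z := by linarith
  set b := z * (1 + l) with hb
  have hzb : z ≤ b := by nlinarith
  set φ := fun w => a / w * (nbExp (fun k => f (k + 1)) (a + 1) w - nbExp f a w) with hφ
  have hM0 : 0 ≤ M := (by positivity : 0 ≤ a * (a + 1) * |nbSecondDiff f a z|).trans (hM z le_rfl)
  -- The mean value inequality for the derivative `φ`, and then for the remainder.
  have d1 : ∀ w ∈ Set.Icc z b, ‖φ w - φ z‖ ≤ M / z ^ 2 * (b - z) := by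
    intro w hw
    refine (Convex.norm_image_sub_le_of_norm_hasDerivWithin_le (s := Set.Icc z b) (C := M / z ^ 2)
      (fun w hw => (hasDerivAt_deriv_nbExp ha (by linarith [hw.1]) hf).hasDerivWithinAt)
      (fun w hw => ?_) (convex_Icc z b) ⟨le_rfl, hzb⟩ hw).trans ?_
    · have hw0 : 0 < w := by linarith [hw.1]
      rw [Real.norm_eq_abs, abs_div, abs_mul, abs_of_pos (by positivity : 0 < a * (a + 1)),
        abs_of_pos (by positivity : 0 < w ^ 2)]
      have h2 : z ^ 2 ≤ w ^ 2 := by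
        gcongr
        exact hw.1
      have h3 := hM w hw.1
      gcongr
    · rw [Real.norm_eq_abs, abs_of_nonneg (by linarith [hw.1])]
      gcongr
      exact hw.2
  have d2 : ‖(nbExp f a b - φ z * b) - (nbExp f a z - φ z * z)‖ ≤
      M / z ^ 2 * (b - z) * ‖b - z‖ := by
    refine Convex.norm_image_sub_le_of_norm_hasDerivWithin_le (s := Set.Icc z b)
      (f := fun w => nbExp f a w - φ z * w) (f' := fun w => φ w - φ z)
      (fun w hw => ?_) d1 (convex_Icc z b) ⟨le_rfl, hzb⟩ ⟨hzb, le_rfl⟩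
    have h := (hasDerivAt_nbExp ha (by linarith [hw.1] : 1 / 2 < w) hf).sub
      ((hasDerivAt_id w).const_mul (φ z))
    rw [mul_one] at h
    exact h.hasDerivWithinAt
  have e1 : b - z = l * z := by rw [hb]; ring
  rw [Real.norm_eq_abs, Real.norm_eq_abs, e1, abs_of_nonneg (by positivity : 0 ≤ l * z)] at d2
  have e2 : M / z ^ 2 * (l * z) * (l * z) = l ^ 2 * M := by field_simp
  rw [e2] at d2
  convert d2 using 2
  have e3 : φ z * b - φ z * z =
      l * (a * (nbExp (fun k => f (k + 1)) (a + 1) z - nbExp f a z)) := by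
    rw [← mul_sub, e1, hφ]
    field_simp
  linarith

/-- The negative binomial laws depend in a Lipschitz way on the logarithm of `z`. -/
lemma abs_nbExp_sub_nbExp_le {a z w : ℝ} (ha : 0 < a) (hz : 1 ≤ z) (hzw : z ≤ w)
    {f : ℕ → ℝ} (hf : ∀ k, f k ∈ Set.Icc (0 : ℝ) 1) :
    |nbExp f a w - nbExp f a z| ≤ a * (w / z - 1) := by
  have hz0 : 0 < z := by linarith
  have h := Convex.norm_image_sub_le_of_norm_hasDerivWithin_le (s := Set.Icc z w) (C := a / z)
    (fun u hu => (hasDerivAt_nbExp ha (by linarith [hu.1] : 1 / 2 < u)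
      (abs_le_one_of_mem_Icc hf)).hasDerivWithinAt)
    (fun u hu => by
      have hu0 : 0 < u := by linarith [hu.1]
      have h0 := nbExp_mem_Icc ha (by linarith [hu.1] : 1 ≤ u) hf
      have h1 := nbExp_mem_Icc (by linarith : 0 < a + 1) (by linarith [hu.1] : 1 ≤ u)
        (f := fun k => f (k + 1)) fun k => hf _
      have h2 : |nbExp (fun k => f (k + 1)) (a + 1) u - nbExp f a u| ≤ 1 := by
        rw [abs_le]
        constructor <;> linarith [h0.1, h0.2, h1.1, h1.2]
      rw [Real.norm_eq_abs, abs_mul, abs_of_pos (by positivity : 0 < a / u)]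
      calc a / u * _ ≤ a / u * 1 := by gcongr
        _ ≤ a / z := by
          rw [mul_one]
          have := hu.1
          gcongr)
    (convex_Icc z w) ⟨le_rfl, hzw⟩ ⟨hzw, le_rfl⟩
  rw [Real.norm_eq_abs, Real.norm_eq_abs, abs_of_nonneg (by linarith : 0 ≤ w - z)] at h
  refine h.trans_eq ?_
  field_simp

/-! ### The in-degree of a group of vertices as a birth chain -/

/-- The expectation of `h` under a probability mass function on a finite type. -/
def pmfExp {α : Type} [Fintype α] (p : PMF α) (h : α → ℝ) : ℝ := ∑ a, (p a).toReal * h a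

section pmfExp

variable {α β : Type} [Fintype α] [Fintype β]

lemma pmfExp_const (p : PMF α) (c : ℝ) : pmfExp p (fun _ => c) = c := by
  have h : ∑ a, (p a).toReal = 1 := by
    have hp := p.tsum_coe
    rw [tsum_fintype] at hp
    rw [← ENNReal.toReal_sum fun a _ => p.apply_ne_top a, hp, ENNReal.toReal_one]
  rw [pmfExp, ← Finset.sum_mul, h, one_mul]

lemma pmfExp_add (p : PMF α) (h g : α → ℝ) :
    pmfExp p (fun a => h a + g a) = pmfExp p h + pmfExp p g := by
  simp [pmfExp, mul_add, Finset.sum_add_distrib]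

lemma pmfExp_const_mul (p : PMF α) (c : ℝ) (h : α → ℝ) :
    pmfExp p (fun a => c * h a) = c * pmfExp p h := by
  simp only [pmfExp, Finset.mul_sum]
  exact Finset.sum_congr rfl fun a _ => by ring

lemma pmfExp_mono (p : PMF α) {h g : α → ℝ} (hg : ∀ a ∈ p.support, h a ≤ g a) :
    pmfExp p h ≤ pmfExp p g := by
  refine Finset.sum_le_sum fun a _ => ?_
  by_cases ha : a ∈ p.support
  · exact mul_le_mul_of_nonneg_left (hg a ha) ENNReal.toReal_nonneg
  · rw [PMF.mem_support_iff, not_not] at ha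
    simp [ha]

lemma pmfExp_congr (p : PMF α) {h g : α → ℝ} (hg : ∀ a ∈ p.support, h a = g a) :
    pmfExp p h = pmfExp p g :=
  le_antisymm (pmfExp_mono p fun a ha => (hg a ha).le) (pmfExp_mono p fun a ha => (hg a ha).ge)

lemma pmfExp_bind (p : PMF α) (q : α → PMF β) (h : β → ℝ) :
    pmfExp (p.bind q) h = pmfExp p fun a => pmfExp (q a) h := by
  have e : ∀ b, (p.bind q b).toReal = ∑ a, (p a).toReal * (q a b).toReal := by
    intro b
    rw [PMF.bind_apply, tsum_fintype, ENNReal.toReal_sum fun a _ =>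
      ENNReal.mul_ne_top (p.apply_ne_top a) ((q a).apply_ne_top b)]
    simp
  simp only [pmfExp, e, Finset.sum_mul, Finset.mul_sum]
  rw [Finset.sum_comm]
  exact Finset.sum_congr rfl fun a _ => Finset.sum_congr rfl fun b _ => by ring

lemma pmfExp_pure (a : α) (h : α → ℝ) : pmfExp (PMF.pure a) h = h a := by
  classical
  rw [pmfExp, Finset.sum_eq_single a]
  · simp
  · intro b _ hb
    simp [hb]
  · simp

lemma pmfExp_map (p : PMF α) (g : α → β) (h : β → ℝ) :
    pmfExp (p.map g) h = pmfExp p fun a => h (g a) := by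
  rw [← PMF.bind_pure_comp, pmfExp_bind]
  exact pmfExp_congr p fun a _ => pmfExp_pure _ _

end pmfExp

namespace DiMultigraph

instance {V E : Type} [Finite V] [Finite E] : Finite (DiMultigraph V E) :=
  Finite.of_injective (β := (E → V) × (E → V)) (fun G => (G.src, G.tgt)) fun G H h => by
    cases G
    cases H
    simp_all

instance {V E : Type} [Finite V] [Finite E] : Fintype (DiMultigraph V E) := Fintype.ofFinite _

/-- The number of edges into the group `i` of vertices, where the vertex `v` is in the
group `v / m`. -/
def groupInDegree (m i : ℕ) {k : ℕ} (G : DiMultigraph (Fin k) (Fin k)) : ℕ :=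
  (Finset.univ.filter fun e => (G.tgt e : ℕ) / m = i).card

end DiMultigraph

/-- The number of vertices of the group `i` among the first `n` vertices. -/
def groupSize (m i n : ℕ) : ℕ := ((Finset.range n).filter fun t => t / m = i).card

lemma filter_div_eq_subset {m : ℕ} (hm : 1 ≤ m) (i n : ℕ) :
    ((Finset.range n).filter fun t => t / m = i) ⊆ Finset.Ico (i * m) ((i + 1) * m) := by
  intro t ht
  have h1 := Nat.div_add_mod t m
  have h2 := Nat.mod_lt t hm
  rw [(Finset.mem_filter.mp ht).2] at h1
  rw [Finset.mem_Ico]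
  constructor <;> nlinarith [Nat.zero_le (t % m)]

lemma groupSize_le {m : ℕ} (hm : 1 ≤ m) (i n : ℕ) : groupSize m i n ≤ m := by
  refine (Finset.card_le_card (filter_div_eq_subset hm i n)).trans_eq ?_
  rw [Nat.card_Ico, add_mul]
  omega

lemma groupSize_eq {m i n : ℕ} (hm : 1 ≤ m) (hn : (i + 1) * m ≤ n) : groupSize m i n = m := by
  refine le_antisymm (groupSize_le hm i n) ?_
  have h : Finset.Ico (i * m) ((i + 1) * m) ⊆ (Finset.range n).filter fun t => t / m = i := by
    intro t ht
    rw [Finset.mem_Ico] at ht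
    rw [Finset.mem_filter, Finset.mem_range]
    exact ⟨by omega, Nat.div_eq_of_lt_le ht.1 ht.2⟩
  refine le_trans (le_of_eq ?_) (Finset.card_le_card h)
  rw [Nat.card_Ico, add_mul]
  omega

namespace DiMultigraph

variable {k : ℕ} {G : DiMultigraph (Fin k) (Fin k)}

lemma groupInDegree_addVertex (m i : ℕ) (G : DiMultigraph (Fin k) (Fin k)) (t : Fin (k + 1)) :
    (G.addVertex t).groupInDegree m i =
      G.groupInDegree m i + if (t : ℕ) / m = i then 1 else 0 := by
  rw [groupInDegree, groupInDegree, Finset.card_filter, Finset.card_filter, Fin.sum_univ_castSucc]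
  simp only [addVertex, Fin.snoc_castSucc, Fin.snoc_last, Fin.val_castSucc]

lemma degree_of_src_eq_id (hG : G.src = id) (v : Fin k) : G.degree v = G.inDegree v + 1 := by
  simp [degree, outDegree, hG, Finset.filter_eq']

lemma sum_inDegree_filter (m i : ℕ) (G : DiMultigraph (Fin k) (Fin k)) :
    ∑ v : Fin k, (if (v : ℕ) / m = i then (G.inDegree v : ℝ) else 0) = G.groupInDegree m i := by
  rw [← Finset.sum_filter, groupInDegree]
  have h := Finset.card_eq_sum_card_fiberwise (f := G.tgt)
    (s := Finset.univ.filter fun e => (G.tgt e : ℕ) / m = i)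
    (t := Finset.univ.filter fun v : Fin k => (v : ℕ) / m = i) (by intro e; simp)
  rw [h, Nat.cast_sum]
  refine Finset.sum_congr rfl fun v hv => ?_
  rw [inDegree, Finset.filter_filter]
  congr 2
  ext e
  simp only [Finset.mem_filter, Finset.mem_univ, true_and] at hv ⊢
  constructor
  · rintro rfl
    exact ⟨hv, rfl⟩
  · exact fun h => h.2

lemma sum_inDegree (G : DiMultigraph (Fin k) (Fin k)) :
    ∑ v : Fin k, (G.inDegree v : ℝ) = k := by
  have h := Finset.card_eq_sum_card_fiberwise (f := G.tgt)
    (s := Finset.univ) (t := Finset.univ) (by intro e; simp)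
  rw [Finset.card_univ, Fintype.card_fin] at h
  conv_rhs => rw [h]
  rw [Nat.cast_sum]
  rfl

lemma sum_attachWeight (hG : G.src = id) (ε : ℝ) :
    ∑ t, G.attachWeight ε t = (2 + ε) * (k + 1) - 1 := by
  rw [Fin.sum_univ_castSucc]
  simp only [attachWeight, Fin.snoc_castSucc, Fin.snoc_last, degree_of_src_eq_id hG]
  push_cast
  simp only [Finset.sum_add_distrib, sum_inDegree]
  simp
  ring

lemma sum_attachWeight_group (hG : G.src = id) (ε : ℝ) (m i : ℕ) :
    ∑ t : Fin (k + 1), (if (t : ℕ) / m = i then G.attachWeight ε t else 0) =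
      G.groupInDegree m i + groupSize m i (k + 1) * (1 + ε) := by
  have h1 : (groupSize m i (k + 1) : ℝ) =
      ∑ v : Fin k, (if (v : ℕ) / m = i then (1 : ℝ) else 0) + if k / m = i then 1 else 0 := by
    rw [groupSize, Finset.card_filter, Finset.sum_range_succ, Finset.sum_range]
    push_cast
    rfl
  rw [Fin.sum_univ_castSucc, h1, ← sum_inDegree_filter, add_mul, Finset.sum_mul, ← add_assoc,
    ← Finset.sum_add_distrib]
  congr 1
  · refine Finset.sum_congr rfl fun v _ => ?_
    simp only [attachWeight, Fin.snoc_castSucc, degree_of_src_eq_id hG, Fin.val_castSucc]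
    split_ifs
    · push_cast
      ring
    · ring
  · simp [attachWeight]

lemma toReal_attachPMF (hG : G.src = id) {ε : ℝ} (hε : -1 < ε) (t : Fin (k + 1)) :
    (G.attachPMF ε hε t).toReal = G.attachWeight ε t / ((2 + ε) * (k + 1) - 1) := by
  have hw : ∀ t, 0 ≤ G.attachWeight ε t := by
    intro t
    refine Fin.lastCases ?_ (fun v => ?_) t
    · simp only [attachWeight, Fin.snoc_last]
      linarith
    · simp only [attachWeight, Fin.snoc_castSucc, degree_of_src_eq_id hG]
      push_cast
      have : (0 : ℝ) ≤ G.inDegree v := by positivity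
      linarith
  rw [attachPMF, PMF.normalize_apply, tsum_fintype, ← ENNReal.ofReal_sum_of_nonneg fun t _ => hw t,
    sum_attachWeight hG, ENNReal.toReal_mul, ENNReal.toReal_ofReal (hw t), ENNReal.toReal_inv,
    ENNReal.toReal_ofReal, div_eq_mul_inv]
  rw [← sum_attachWeight hG]
  exact Finset.sum_nonneg fun t _ => hw t

lemma pmfExp_attachPMF (hG : G.src = id) {ε : ℝ} (hε : -1 < ε) (m i : ℕ) (h : ℕ → ℝ) :
    pmfExp (G.attachPMF ε hε) (fun t => h ((G.addVertex t).groupInDegree m i)) =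
      h (G.groupInDegree m i) + (G.groupInDegree m i + groupSize m i (k + 1) * (1 + ε)) /
        ((2 + ε) * (k + 1) - 1) * (h (G.groupInDegree m i + 1) - h (G.groupInDegree m i)) := by
  have e : ∀ t : Fin (k + 1), h ((G.addVertex t).groupInDegree m i) = h (G.groupInDegree m i) +
      (h (G.groupInDegree m i + 1) - h (G.groupInDegree m i)) *
        if (t : ℕ) / m = i then 1 else 0 := by
    intro t
    rw [groupInDegree_addVertex]
    split_ifs <;> simp
  simp only [e]
  rw [pmfExp_add, pmfExp_const, pmfExp_const_mul, mul_comm (_ / _)]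
  congr 2
  rw [pmfExp, ← sum_attachWeight_group hG, Finset.sum_div]
  refine Finset.sum_congr rfl fun t _ => ?_
  rw [toReal_attachPMF hG]
  split_ifs <;> simp

end DiMultigraph

lemma src_eq_id_of_mem_support {ε : ℝ} (hε : -1 < ε) :
    ∀ {k : ℕ} {G : DiMultigraph (Fin k) (Fin k)}, G ∈ (prefAttachOne ε hε k).support →
      G.src = id
  | 0, G, _ => Subsingleton.elim _ _
  | k + 1, G, hG => by
    rw [prefAttachOne, PMF.mem_support_bind_iff] at hG
    obtain ⟨G', hG', hG⟩ := hG
    rw [PMF.mem_support_map_iff] at hG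
    obtain ⟨t, _, rfl⟩ := hG
    have h := src_eq_id_of_mem_support hε hG'
    funext e
    refine Fin.lastCases ?_ (fun v => ?_) e <;> simp [DiMultigraph.addVertex, h]

/-- The expectation of `h` at the in-degree of the group `i` when the graph has `k` vertices. -/
def groupExp (ε : ℝ) (hε : -1 < ε) (m i k : ℕ) (h : ℕ → ℝ) : ℝ :=
  pmfExp (prefAttachOne ε hε k) fun G => h (G.groupInDegree m i)

/-- The in-degree of a group is a Markov chain with steps zero and one. -/
lemma groupExp_succ {ε : ℝ} (hε : -1 < ε) (m i k : ℕ) (h : ℕ → ℝ) :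
    groupExp ε hε m i (k + 1) h = groupExp ε hε m i k fun x =>
      h x + (x + groupSize m i (k + 1) * (1 + ε)) / ((2 + ε) * (k + 1) - 1) *
        (h (x + 1) - h x) := by
  rw [groupExp, prefAttachOne, pmfExp_bind]
  refine pmfExp_congr _ fun G hG => ?_
  rw [pmfExp_map, DiMultigraph.pmfExp_attachPMF (src_eq_id_of_mem_support hε hG)]

/-- No edge enters a group before its first vertex is added. -/
lemma groupExp_of_le {ε : ℝ} (hε : -1 < ε) {m i k : ℕ} (hk : k ≤ i * m)
    (h : ℕ → ℝ) : groupExp ε hε m i k h = h 0 := by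
  rw [groupExp, ← pmfExp_const (prefAttachOne ε hε k) (h 0)]
  refine pmfExp_congr _ fun G _ => ?_
  congr 1
  rw [DiMultigraph.groupInDegree, Finset.card_eq_zero, Finset.filter_eq_empty_iff]
  intro e _
  exact (Nat.div_lt_of_lt_mul (by have := (G.tgt e).isLt; rw [mul_comm]; omega)).ne

lemma integral_inDegreeLaw (m : ℕ) (δ : ℝ) (hδ : -(m : ℝ) < δ) (n : ℕ) (i : Fin n) (h : ℕ → ℝ) :
    ∫ w, h w ∂(inDegreeLaw m δ hδ n i) =
      groupExp (δ / m) (neg_one_lt_div_of_neg_lt hδ) m i (n * m) h := by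
  let _ : MeasurableSpace (DiMultigraph (Fin (n * m)) (Fin (n * m))) := ⊤
  rw [inDegreeLaw, prefAttach, PMF.map_comp, ← PMF.toMeasure_map _ _ measurable_from_top,
    integral_map measurable_from_top.aemeasurable
      (measurable_of_countable h).aestronglyMeasurable, PMF.integral_eq_sum]
  refine Finset.sum_congr rfl fun G _ => ?_
  have e : (G.collapse Fin.divNat).inDegree i = G.groupInDegree m i := by
    simp [DiMultigraph.inDegree, DiMultigraph.groupInDegree, DiMultigraph.collapse, Fin.ext_iff]
  rw [smul_eq_mul, Function.comp_apply, e]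

/-! ### Power sums -/

lemma div_succ_rpow_le {τ : ℝ} (h0 : 0 ≤ τ) (h1 : τ ≤ 1) (j : ℕ) :
    ((j : ℝ) / (j + 1)) ^ τ ≤ 1 - τ / (j + 1) := by
  have hj : (0 : ℝ) < j + 1 := by positivity
  have hs : (-1 : ℝ) ≤ -(1 / (j + 1)) := by
    rw [neg_le_neg_iff, div_le_one hj]
    linarith [(by positivity : (0 : ℝ) ≤ j)]
  have h := rpow_one_add_le_one_add_mul_self hs h0 h1
  have e : (j : ℝ) / (j + 1) = 1 + -(1 / (j + 1)) := by
    field_simp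
    ring
  rw [e]
  refine h.trans_eq ?_
  ring

lemma sum_Ico_rpow_le {τ : ℝ} (h0 : 0 < τ) (h1 : τ ≤ 1) {a b : ℕ} (ha : 1 ≤ a) (hab : a ≤ b) :
    ∑ j ∈ Finset.Ico a b, (j : ℝ) ^ (-(1 + τ)) ≤ 2 / τ * (a : ℝ) ^ (-τ) := by
  suffices h : ∑ j ∈ Finset.Ico a b, (j : ℝ) ^ (-(1 + τ)) ≤
      2 / τ * ((a : ℝ) ^ (-τ) - (b : ℝ) ^ (-τ)) by
    refine h.trans ?_
    have : (0 : ℝ) ≤ (b : ℝ) ^ (-τ) := by positivity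
    gcongr
    linarith
  induction b, hab using Nat.le_induction with
  | base => simp
  | succ j hj ih =>
    rw [Finset.sum_Ico_succ_top hj]
    have hj1 : (1 : ℝ) ≤ j := by exact_mod_cast ha.trans hj
    have hj0 : (0 : ℝ) < j := by linarith
    have h := div_succ_rpow_le h0.le h1 j
    have e1 : ((j : ℝ) + 1) ^ (-τ) = (j : ℝ) ^ (-τ) * ((j : ℝ) / (j + 1)) ^ τ := by
      rw [Real.div_rpow hj0.le (by positivity), Real.rpow_neg hj0.le, Real.rpow_neg (by positivity)]
      field_simp
    have e2 : (j : ℝ) ^ (-(1 + τ)) = (j : ℝ) ^ (-τ) * (1 / j) := by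
      rw [show -(1 + τ) = -τ - 1 by ring, Real.rpow_sub_one hj0.ne']
      ring
    have h3 : (1 : ℝ) / j ≤ 2 / τ * (τ / (j + 1)) := by
      rw [div_mul_div_cancel₀ h0.ne', div_le_div_iff₀ hj0 (by positivity)]
      linarith
    have key : (j : ℝ) ^ (-(1 + τ)) ≤ 2 / τ * ((j : ℝ) ^ (-τ) - ((j : ℝ) + 1) ^ (-τ)) := by
      rw [e1, e2]
      have hp : 0 < (j : ℝ) ^ (-τ) := by positivity
      calc (j : ℝ) ^ (-τ) * (1 / j) ≤ (j : ℝ) ^ (-τ) * (2 / τ * (τ / (j + 1))) := by gcongr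
        _ ≤ (j : ℝ) ^ (-τ) * (2 / τ * (1 - ((j : ℝ) / (j + 1)) ^ τ)) := by
          gcongr
          linarith
        _ = _ := by ring
    push_cast
    linarith

lemma sum_range_succ_rpow_le {θ : ℝ} (h0 : 0 < θ) (h1 : θ ≤ 1) (n : ℕ) :
    ∑ d ∈ Finset.range n, ((d : ℝ) + 1) ^ (θ - 1) ≤ (n : ℝ) ^ θ / θ := by
  induction n with
  | zero => simp [h0.ne']
  | succ d ih =>
    rw [Finset.sum_range_succ]
    have hd : (0 : ℝ) < (d : ℝ) + 1 := by positivity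
    have h := div_succ_rpow_le h0.le h1 d
    rw [Real.div_rpow (by positivity) hd.le, div_le_iff₀ (by positivity)] at h
    have e : ((d : ℝ) + 1) ^ (θ - 1) = ((d : ℝ) + 1) ^ θ / (d + 1) := Real.rpow_sub_one hd.ne' θ
    have key : ((d : ℝ) + 1) ^ (θ - 1) ≤ (((d : ℝ) + 1) ^ θ - (d : ℝ) ^ θ) / θ := by
      rw [le_div_iff₀ h0, e]
      have : (1 - θ / ((d : ℝ) + 1)) * ((d : ℝ) + 1) ^ θ =
        ((d : ℝ) + 1) ^ θ - ((d : ℝ) + 1) ^ θ / (d + 1) * θ := by ring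
      linarith
    push_cast
    rw [sub_div] at key
    linarith

lemma sum_Ico_sub_rpow_le {θ : ℝ} (h0 : 0 < θ) (h1 : θ ≤ 1) (a N : ℕ) :
    ∑ j ∈ Finset.Ico a N, ((N : ℝ) - j) ^ (θ - 1) ≤ (N : ℝ) ^ θ / θ := by
  refine le_trans ?_ (sum_range_succ_rpow_le h0 h1 N)
  rw [← Finset.sum_range_reflect]
  have e : ∀ j ∈ Finset.range N,
      (((N - 1 - j : ℕ) : ℝ) + 1) ^ (θ - 1) = ((N : ℝ) - j) ^ (θ - 1) := by
    intro j hj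
    rw [Finset.mem_range] at hj
    rw [Nat.cast_sub (by omega), Nat.cast_sub (by omega)]
    push_cast
    ring_nf
  rw [Finset.sum_congr rfl e]
  refine Finset.sum_le_sum_of_subset_of_nonneg (fun j hj => ?_) fun j hj _ => ?_
  · rw [Finset.mem_Ico] at hj
    exact Finset.mem_range.mpr hj.2
  · have : (j : ℝ) ≤ N := by exact_mod_cast (Finset.mem_range.mp hj).le
    exact Real.rpow_nonneg (by linarith) _

lemma min_le_rpow_mul_rpow {x w θ : ℝ} (hx : 0 < x) (hw : 0 < w) (h0 : 0 ≤ θ) (h1 : θ ≤ 1) :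
    min (x ^ 2) (x * w) ≤ x ^ (1 + θ) * w ^ (1 - θ) := by
  rcases le_total w x with h | h
  · refine (min_le_right _ _).trans ?_
    have e1 : x ^ (1 + θ) = x * x ^ θ := by rw [Real.rpow_add hx, Real.rpow_one]
    have e2 : w = w ^ θ * w ^ (1 - θ) := by
      rw [← Real.rpow_add hw, add_sub_cancel, Real.rpow_one]
    calc x * w = x * (w ^ θ * w ^ (1 - θ)) := by rw [← e2]
      _ ≤ x * (x ^ θ * w ^ (1 - θ)) := by gcongr
      _ = _ := by rw [e1]; ring
  · refine (min_le_left _ _).trans ?_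
    have e1 : x ^ 2 = x ^ (1 + θ) * x ^ (1 - θ) := by
      rw [← Real.rpow_add hx, show 1 + θ + (1 - θ) = (2 : ℕ) by push_cast; ring, Real.rpow_natCast]
    rw [e1]
    have : 0 ≤ 1 - θ := by linarith
    gcongr

/-- The sum that bounds the total error. The first of the two bounds whose minimum is taken is too
large on its own when `α ≥ 1 / 2`, since the exponent `2 * α - 2` is then at least `-1`; the second
is too large by a logarithm that comes from the upper end. Interpolating between them with a small
exponent `θ` on the first one gives the right order. -/
lemma exists_sum_min_le {α : ℝ} (hα0 : 0 < α) (hα1 : α < 1) :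
    ∃ C : ℝ, 0 ≤ C ∧ ∀ a N : ℕ, 1 ≤ a → a ≤ N →
      ∑ j ∈ Finset.Ico a N, 1 / (j : ℝ) ^ 2 *
        min ((((j : ℝ) / a) ^ α) ^ 2) (((j : ℝ) / a) ^ α * (N / ((N : ℝ) - j))) ≤ C / a := by
  -- Any `θ` such that `γ = α * (1 + θ) < 1` works; here `1 - γ = (1 - α) * (2 - α) / 2`.
  obtain ⟨θ, γ, hθ0, hθ1, hγ, hγ0, hγ1⟩ : ∃ θ γ : ℝ, 0 < θ ∧ θ ≤ 1 ∧ γ = α * (1 + θ) ∧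
      0 < γ ∧ γ < 1 :=
    ⟨(1 - α) / 2, α * (1 + (1 - α) / 2), by linarith, by linarith, rfl, by nlinarith, by nlinarith⟩
  refine ⟨2 * (2 / (1 - γ)) + 4 / θ, ?_, ?_⟩
  · have : 0 < 1 - γ := by linarith
    positivity
  intro a N ha haN
  have ha0 : (0 : ℝ) < a := by exact_mod_cast ha
  have hN0 : (0 : ℝ) < N := by exact_mod_cast ha.trans haN
  have haN' : (a : ℝ) ≤ N := by exact_mod_cast haN
  have term : ∀ j ∈ Finset.Ico a N, 1 / (j : ℝ) ^ 2 *
      min ((((j : ℝ) / a) ^ α) ^ 2) (((j : ℝ) / a) ^ α * (N / ((N : ℝ) - j))) ≤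
      2 * (a : ℝ) ^ (-γ) * (j : ℝ) ^ (-(1 + (1 - γ))) +
        4 * (a : ℝ) ^ (-γ) * (N : ℝ) ^ (γ - 1 - θ) * ((N : ℝ) - j) ^ (θ - 1) := by
    intro j hj
    rw [Finset.mem_Ico] at hj
    have hj0 : (0 : ℝ) < j := by exact_mod_cast ha.trans hj.1
    have hjN : (0 : ℝ) < (N : ℝ) - j := by
      rw [sub_pos]
      exact_mod_cast hj.2
    set w := (N : ℝ) / ((N : ℝ) - j) with hw
    have hw0 : 0 < w := by positivity
    have hmin := min_le_rpow_mul_rpow (x := ((j : ℝ) / a) ^ α) (by positivity) hw0 hθ0.le hθ1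
    rw [← Real.rpow_mul (by positivity) α (1 + θ), ← hγ, Real.div_rpow hj0.le ha0.le γ] at hmin
    have e1 : (j : ℝ) ^ (-(1 + (1 - γ))) = 1 / (j : ℝ) ^ 2 * (j : ℝ) ^ γ := by
      rw [show -(1 + (1 - γ)) = γ - (2 : ℕ) by push_cast; ring, Real.rpow_sub_natCast hj0.ne']
      ring
    have e2 : 1 / (j : ℝ) ^ 2 * ((j : ℝ) ^ γ / (a : ℝ) ^ γ * w ^ (1 - θ)) =
        (a : ℝ) ^ (-γ) * (j : ℝ) ^ (-(1 + (1 - γ))) * w ^ (1 - θ) := by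
      rw [e1, Real.rpow_neg ha0.le]
      ring
    refine (mul_le_mul_of_nonneg_left hmin (by positivity : 0 ≤ 1 / (j : ℝ) ^ 2)).trans ?_
    rw [e2]
    -- The first summand of the bound accounts for `j ≤ N / 2`, the second one for `j ≥ N / 2`.
    rcases le_total (2 * (j : ℝ)) N with h | h
    · have hw2 : w ^ (1 - θ) ≤ 2 := by
        have h2 : w ≤ 2 := by
          rw [hw, div_le_iff₀ hjN]
          linarith
        calc w ^ (1 - θ) ≤ 2 ^ (1 - θ) := by
              have : 0 ≤ 1 - θ := by linarith
              gcongr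
          _ ≤ (2 : ℝ) ^ (1 : ℝ) := Real.rpow_le_rpow_of_exponent_le (by norm_num) (by linarith)
          _ = 2 := Real.rpow_one 2
      have h3 : 0 ≤ 4 * (a : ℝ) ^ (-γ) * (N : ℝ) ^ (γ - 1 - θ) * ((N : ℝ) - j) ^ (θ - 1) := by
        positivity
      have h4 : 0 ≤ (a : ℝ) ^ (-γ) * (j : ℝ) ^ (-(1 + (1 - γ))) := by positivity
      nlinarith
    · have hj2 : (j : ℝ) ^ (-(1 + (1 - γ))) ≤ 4 * (N : ℝ) ^ (γ - 2) := by
        rw [show -(1 + (1 - γ)) = γ - 2 by ring]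
        calc (j : ℝ) ^ (γ - 2) ≤ ((N : ℝ) / 2) ^ (γ - 2) :=
              Real.rpow_le_rpow_of_nonpos (by positivity) (by linarith) (by linarith)
          _ = (N : ℝ) ^ (γ - 2) * 2 ^ (2 - γ) := by
              rw [Real.div_rpow hN0.le (by norm_num), show 2 - γ = -(γ - 2) by ring,
                Real.rpow_neg (by norm_num), div_eq_mul_inv]
          _ ≤ (N : ℝ) ^ (γ - 2) * 2 ^ (2 : ℝ) := by
              gcongr
              · norm_num
              · linarith
          _ = 4 * (N : ℝ) ^ (γ - 2) := by norm_num; ring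
      have e3 : w ^ (1 - θ) = (N : ℝ) ^ (1 - θ) * ((N : ℝ) - j) ^ (θ - 1) := by
        rw [hw, Real.div_rpow hN0.le hjN.le, show θ - 1 = -(1 - θ) by ring,
          Real.rpow_neg hjN.le, div_eq_mul_inv]
      have e4 : (N : ℝ) ^ (γ - 1 - θ) = (N : ℝ) ^ (γ - 2) * (N : ℝ) ^ (1 - θ) := by
        rw [← Real.rpow_add hN0]
        congr 1
        ring
      calc (a : ℝ) ^ (-γ) * (j : ℝ) ^ (-(1 + (1 - γ))) * w ^ (1 - θ)
          ≤ (a : ℝ) ^ (-γ) * (4 * (N : ℝ) ^ (γ - 2)) * w ^ (1 - θ) := by gcongr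
        _ = 4 * (a : ℝ) ^ (-γ) * (N : ℝ) ^ (γ - 1 - θ) * ((N : ℝ) - j) ^ (θ - 1) := by
          rw [e3, e4]
          ring
        _ ≤ _ := le_add_of_nonneg_left (by positivity)
  refine (Finset.sum_le_sum term).trans ?_
  rw [Finset.sum_add_distrib, ← Finset.mul_sum, ← Finset.mul_sum, add_div]
  have s1 := sum_Ico_rpow_le (τ := 1 - γ) (by linarith) (by linarith) ha haN
  have s2 := sum_Ico_sub_rpow_le hθ0 hθ1 a N
  have hinv : (a : ℝ) ^ (-γ) * (a : ℝ) ^ (γ - 1) = 1 / a := by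
    rw [← Real.rpow_add ha0, show -γ + (γ - 1) = -1 by ring, Real.rpow_neg_one, one_div]
  refine add_le_add ?_ ?_
  · calc _ ≤ 2 * (a : ℝ) ^ (-γ) * (2 / (1 - γ) * (a : ℝ) ^ (-(1 - γ))) := by gcongr
      _ = 2 * (2 / (1 - γ)) * ((a : ℝ) ^ (-γ) * (a : ℝ) ^ (γ - 1)) := by
        rw [show -(1 - γ) = γ - 1 by ring]
        ring
      _ = _ := by rw [hinv]; ring
  · calc _ ≤ 4 * (a : ℝ) ^ (-γ) * (N : ℝ) ^ (γ - 1 - θ) * ((N : ℝ) ^ θ / θ) := by gcongr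
      _ = 4 / θ * ((a : ℝ) ^ (-γ) * (N : ℝ) ^ (γ - 1)) := by
        rw [Real.rpow_sub hN0 (γ - 1) θ]
        field_simp
      _ ≤ 4 / θ * ((a : ℝ) ^ (-γ) * (a : ℝ) ^ (γ - 1)) := by
        have := Real.rpow_le_rpow_of_nonpos ha0 haN' (by linarith : γ - 1 ≤ 0)
        gcongr
      _ = _ := by rw [hinv]; ring

lemma one_add_div_le_rpow {α : ℝ} (hα0 : 0 < α) (hα1 : α < 1) {k : ℕ} (hk : 1 ≤ k) :
    1 + α / (k + 1 - α) ≤ (((k : ℝ) + 1) / k) ^ α := by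
  have hk0 : (1 : ℝ) ≤ k := by exact_mod_cast hk
  have h := div_succ_rpow_le hα0.le hα1.le k
  have h1 : 0 < 1 - α / ((k : ℝ) + 1) := by
    rw [sub_pos, div_lt_one (by positivity)]
    linarith
  have e1 : 1 + α / ((k : ℝ) + 1 - α) = (1 - α / ((k : ℝ) + 1))⁻¹ := by
    have h2 : (k : ℝ) + 1 - α ≠ 0 := by linarith
    have h3 : (k : ℝ) + 1 ≠ 0 := by positivity
    rw [one_sub_div h3, inv_div]
    field_simp
    ring
  have e2 : (((k : ℝ) + 1) / k) ^ α = (((k : ℝ) / (k + 1)) ^ α)⁻¹ := by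
    rw [← Real.inv_rpow (by positivity), inv_div]
  rw [e1, e2]
  exact inv_anti₀ (by positivity) h

lemma prod_one_add_div_le {α : ℝ} (hα0 : 0 < α) (hα1 : α < 1) {a b : ℕ} (ha : 1 ≤ a)
    (hab : a ≤ b) :
    ∏ k ∈ Finset.Ico a b, (1 + α / ((k : ℝ) + 1 - α)) ≤ ((b : ℝ) / a) ^ α := by
  have ha0 : (0 : ℝ) < a := by exact_mod_cast ha
  induction b, hab using Nat.le_induction with
  | base => simp [ha0.ne']
  | succ j hj ih =>
    have hj1 : 1 ≤ j := ha.trans hj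
    have hj0 : (0 : ℝ) < j := by exact_mod_cast hj1
    have h1 : (1 : ℝ) ≤ j := by exact_mod_cast hj1
    rw [Finset.prod_Ico_succ_top hj]
    have h2 : 0 < (j : ℝ) + 1 - α := by linarith
    calc _ ≤ ((j : ℝ) / a) ^ α * (((j : ℝ) + 1) / j) ^ α := by
          have := one_add_div_le_rpow hα0 hα1 hj1
          gcongr
      _ = _ := by
          rw [← Real.mul_rpow (by positivity) (by positivity)]
          congr 1
          push_cast
          field_simp

/-! ### Growth of the birth chain -/

/-- The reciprocal of the total weight when the graph has `k` vertices, for `α = 1 / (2 + ε)`. -/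
def attachRate (α : ℝ) (k : ℕ) : ℝ := α / ((k : ℝ) + 1 - α)

/-- The factor by which the mean weight of a complete group grows while the number of vertices
goes from `j` to `N`. -/
def growth (α : ℝ) (j N : ℕ) : ℝ := ∏ k ∈ Finset.Ico j N, (1 + attachRate α k)

section rate

variable {α : ℝ}

lemma attachRate_pos (hα0 : 0 < α) (hα1 : α < 1) (k : ℕ) : 0 < attachRate α k := by
  have hk : (0 : ℝ) ≤ k := by positivity
  have : 0 < (k : ℝ) + 1 - α := by linarith
  unfold attachRate
  positivity

lemma attachRate_le_inv (hα0 : 0 < α) (hα1 : α < 1) {k : ℕ} (hk : 1 ≤ k) :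
    attachRate α k ≤ 1 / k := by
  have hk1 : (1 : ℝ) ≤ k := by exact_mod_cast hk
  unfold attachRate
  rw [div_le_div_iff₀ (by linarith) (by linarith)]
  nlinarith

lemma attachRate_le (hα0 : 0 < α) (hα1 : α < 1) {i k : ℕ} (hk : i ≤ k) :
    attachRate α k ≤ α / (1 - α) / (i + 1) := by
  have hk1 : (i : ℝ) ≤ k := by exact_mod_cast hk
  have hi : (0 : ℝ) ≤ i := by positivity
  unfold attachRate
  rw [div_div]
  have : 0 < (1 - α) * ((i : ℝ) + 1) := by
    have : 0 < 1 - α := by linarith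
    positivity
  refine div_le_div_of_nonneg_left hα0.le this ?_
  nlinarith

lemma le_attachRate (hα0 : 0 < α) (hα1 : α < 1) {k N : ℕ} (hk : k < N) :
    α / N ≤ attachRate α k := by
  have hk1 : (k : ℝ) + 1 ≤ N := by exact_mod_cast hk
  have hk0 : (0 : ℝ) ≤ k := by positivity
  unfold attachRate
  exact div_le_div_of_nonneg_left hα0.le (by linarith) (by linarith)

lemma growth_self (j : ℕ) : growth α j j = 1 := by simp [growth]

lemma growth_eq_mul {j N : ℕ} (hj : j < N) :
    growth α j N = growth α (j + 1) N * (1 + attachRate α j) := by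
  rw [growth, Finset.prod_eq_prod_Ico_succ_bot hj, mul_comm, growth]

lemma growth_succ {j N : ℕ} (hj : j ≤ N) :
    growth α j (N + 1) = growth α j N * (1 + attachRate α N) := by
  rw [growth, Finset.prod_Ico_succ_top hj, growth]

lemma one_add_le_growth (hα0 : 0 < α) (hα1 : α < 1) (j N : ℕ) :
    1 + ((N : ℝ) - j) * (α / N) ≤ growth α j N := by
  rcases le_or_gt N j with h | h
  · rw [growth, Finset.Ico_eq_empty_of_le h, Finset.prod_empty]
    have h1 : (N : ℝ) - j ≤ 0 := by
      rw [sub_nonpos]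
      exact_mod_cast h
    have h2 : 0 ≤ α / N := by positivity
    nlinarith
  · have key : ∀ s : Finset ℕ, 1 + ∑ k ∈ s, attachRate α k ≤ ∏ k ∈ s, (1 + attachRate α k) := by
      intro s
      induction s using Finset.cons_induction with
      | empty => simp
      | cons a s ha ih =>
        rw [Finset.sum_cons, Finset.prod_cons]
        have h1 := attachRate_pos hα0 hα1 a
        have h2 : 0 ≤ ∑ k ∈ s, attachRate α k :=
          Finset.sum_nonneg fun k _ => (attachRate_pos hα0 hα1 k).le
        nlinarith
    refine le_trans ?_ (key _)
    have h3 := Finset.card_nsmul_le_sum (Finset.Ico j N) (attachRate α) (α / N) fun k hk =>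
      le_attachRate hα0 hα1 (Finset.mem_Ico.mp hk).2
    rw [Nat.card_Ico, nsmul_eq_mul, Nat.cast_sub h.le] at h3
    linarith

lemma one_le_growth (hα0 : 0 < α) (hα1 : α < 1) (j N : ℕ) : 1 ≤ growth α j N := by
  unfold growth
  exact Finset.prod_induction _ (1 ≤ ·) (fun _ _ => one_le_mul_of_one_le_of_one_le) le_rfl
    fun k _ => by linarith [attachRate_pos hα0 hα1 k]

lemma growth_le (hα0 : 0 < α) (hα1 : α < 1) {a b : ℕ} (ha : 1 ≤ a) (hab : a ≤ b) :
    growth α a b ≤ ((b : ℝ) / a) ^ α := prod_one_add_div_le hα0 hα1 ha hab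

/-- The bound on the ratio that governs the regularizing effect over the remaining time. -/
lemma div_growth_sub_one_le (hα0 : 0 < α) (hα1 : α < 1) {j N : ℕ} (hj : j + 1 < N) :
    growth α (j + 1) N / (growth α (j + 1) N - 1) ≤ (1 + 2 / α) * (N / ((N : ℝ) - j)) := by
  have h := one_add_le_growth hα0 hα1 (j + 1) N
  have hj2 : (j : ℝ) + 2 ≤ N := by exact_mod_cast hj
  have hj0 : (0 : ℝ) ≤ j := by positivity
  have hN : (0 : ℝ) < N := by linarith
  have hd : 0 < (N : ℝ) - j := by linarith
  push_cast at h
  have hα : 0 < α / N := by positivity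
  have h1 : ((N : ℝ) - j) / 2 * (α / N) ≤ growth α (j + 1) N - 1 := by nlinarith
  have h2 : 0 < ((N : ℝ) - j) / 2 * (α / N) := by positivity
  have h3 : growth α (j + 1) N / (growth α (j + 1) N - 1) =
      1 + 1 / (growth α (j + 1) N - 1) := by
    have : growth α (j + 1) N - 1 ≠ 0 := by linarith
    field_simp
    ring
  have h4 : 1 / (growth α (j + 1) N - 1) ≤ 1 / (((N : ℝ) - j) / 2 * (α / N)) :=
    one_div_le_one_div_of_le h2 h1
  have h5 : 1 / (((N : ℝ) - j) / 2 * (α / N)) = 2 / α * (N / ((N : ℝ) - j)) := by field_simp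
  have h6 : (1 : ℝ) ≤ N / ((N : ℝ) - j) := by
    rw [one_le_div hd]
    linarith
  rw [h3]
  linarith

end rate

section chain

variable {ε α r : ℝ} {m i : ℕ}

lemma groupExp_const (hε : -1 < ε) (k : ℕ) (c : ℝ) : groupExp ε hε m i k (fun _ => c) = c :=
  pmfExp_const _ c

lemma groupExp_add (hε : -1 < ε) (k : ℕ) (f g : ℕ → ℝ) :
    groupExp ε hε m i k (fun x => f x + g x) = groupExp ε hε m i k f + groupExp ε hε m i k g :=
  pmfExp_add _ _ _

lemma groupExp_const_mul (hε : -1 < ε) (k : ℕ) (c : ℝ) (f : ℕ → ℝ) :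
    groupExp ε hε m i k (fun x => c * f x) = c * groupExp ε hε m i k f :=
  pmfExp_const_mul _ _ _

lemma groupExp_mono (hε : -1 < ε) (k : ℕ) {f g : ℕ → ℝ} (h : ∀ x, f x ≤ g x) :
    groupExp ε hε m i k f ≤ groupExp ε hε m i k g :=
  pmfExp_mono _ fun _ _ => h _

lemma groupExp_nonneg (hε : -1 < ε) (k : ℕ) {f : ℕ → ℝ} (h : ∀ x, 0 ≤ f x) :
    0 ≤ groupExp ε hε m i k f :=
  (groupExp_const (m := m) (i := i) hε k 0).symm.trans_le (groupExp_mono hε k h)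

lemma abs_groupExp_sub_le (hε : -1 < ε) (k : ℕ) {f g B : ℕ → ℝ} (h : ∀ x, |f x - g x| ≤ B x) :
    |groupExp ε hε m i k f - groupExp ε hε m i k g| ≤ groupExp ε hε m i k B := by
  have h1 := groupExp_mono (m := m) (i := i) hε k (f := f) (g := fun x => g x + B x)
    fun x => by linarith [(abs_le.mp (h x)).2]
  have h2 := groupExp_mono (m := m) (i := i) hε k (f := g) (g := fun x => f x + B x)
    fun x => by linarith [(abs_le.mp (h x)).1]
  rw [groupExp_add] at h1 h2
  rw [abs_le]
  constructor <;> linarith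

lemma groupExp_succ_eq (hε : -1 < ε) (hα : α * (2 + ε) = 1) (k : ℕ) (h : ℕ → ℝ) :
    groupExp ε hε m i (k + 1) h = groupExp ε hε m i k fun x =>
      h x + attachRate α k * ((x + groupSize m i (k + 1) * (1 + ε)) * (h (x + 1) - h x)) := by
  rw [groupExp_succ]
  congr 1
  funext x
  have h2 : (0 : ℝ) < 2 + ε := by linarith
  have e : attachRate α k = 1 / ((2 + ε) * ((k : ℝ) + 1) - 1) := by
    have : α = 1 / (2 + ε) := by
      field_simp
      exact hα
    rw [attachRate, this]
    field_simp
  rw [e]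
  ring

/-- The chain once the group is complete. -/
lemma groupExp_succ_of_le (hε : -1 < ε) (hα : α * (2 + ε) = 1) (hm : 1 ≤ m)
    (hr : r = m * (1 + ε)) {k : ℕ} (hk : (i + 1) * m ≤ k) (h : ℕ → ℝ) :
    groupExp ε hε m i (k + 1) h = groupExp ε hε m i k fun x =>
      h x + attachRate α k * ((x + r) * (h (x + 1) - h x)) := by
  rw [groupExp_succ_eq hε hα, groupSize_eq hm (by omega), hr]

/-- For increasing functions, replacing the weight of a group under construction by that of the
complete group gives an upper bound. -/
lemma groupExp_succ_le (hε : -1 < ε) (hα : α * (2 + ε) = 1) (hα0 : 0 < α) (hα1 : α < 1)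
    (hm : 1 ≤ m) (hr : r = m * (1 + ε)) (k : ℕ) {h : ℕ → ℝ} (hh : ∀ x, h x ≤ h (x + 1)) :
    groupExp ε hε m i (k + 1) h ≤ groupExp ε hε m i k fun x =>
      h x + attachRate α k * ((x + r) * (h (x + 1) - h x)) := by
  rw [groupExp_succ_eq hε hα]
  refine groupExp_mono hε k fun x => ?_
  have h1 := attachRate_pos hα0 hα1 k
  have h2 : (groupSize m i (k + 1) : ℝ) ≤ m := by exact_mod_cast groupSize_le hm i (k + 1)
  have h3 : 0 ≤ h (x + 1) - h x := by linarith [hh x]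
  have h4 : 0 ≤ 1 + ε := by linarith
  rw [hr]
  gcongr

lemma groupExp_weight_eq (hε : -1 < ε) (hα : α * (2 + ε) = 1) (hm : 1 ≤ m)
    (hr : r = m * (1 + ε)) {k : ℕ} (hk : (i + 1) * m ≤ k) :
    groupExp ε hε m i k (fun x => (x : ℝ) + r) =
      groupExp ε hε m i ((i + 1) * m) (fun x => (x : ℝ) + r) * growth α ((i + 1) * m) k := by
  induction k, hk using Nat.le_induction with
  | base => rw [growth_self, mul_one]
  | succ k hk ih =>
    rw [groupExp_succ_of_le hε hα hm hr hk, growth_succ hk, ← mul_assoc, ← ih, mul_comm,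
      ← groupExp_const_mul]
    congr 1
    funext x
    push_cast
    ring

lemma groupExp_weight_succ_le (hε : -1 < ε) (hα : α * (2 + ε) = 1) (hα0 : 0 < α) (hα1 : α < 1)
    (hm : 1 ≤ m) (hr : r = m * (1 + ε)) (k : ℕ) :
    groupExp ε hε m i (k + 1) (fun x => (x : ℝ) + r) ≤
      (1 + attachRate α k) * groupExp ε hε m i k (fun x => (x : ℝ) + r) := by
  refine (groupExp_succ_le hε hα hα0 hα1 hm hr k fun x => by push_cast; linarith).trans_eq ?_
  rw [← groupExp_const_mul]
  congr 1
  funext x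
  push_cast
  ring

lemma groupExp_weight_sq_succ_le (hε : -1 < ε) (hα : α * (2 + ε) = 1) (hα0 : 0 < α)
    (hα1 : α < 1) (hm : 1 ≤ m) (hr : r = m * (1 + ε)) (hr0 : 0 < r) (k : ℕ) :
    groupExp ε hε m i (k + 1) (fun x => ((x : ℝ) + r) * (x + r + 1)) ≤
      (1 + attachRate α k) ^ 2 *
        groupExp ε hε m i k (fun x => ((x : ℝ) + r) * (x + r + 1)) := by
  refine (groupExp_succ_le hε hα hα0 hα1 hm hr k fun x => ?_).trans ?_
  · have : (0 : ℝ) ≤ x := by positivity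
    push_cast
    nlinarith
  rw [← groupExp_const_mul]
  refine groupExp_mono hε k fun x => ?_
  have h : 0 ≤ attachRate α k ^ 2 * (((x : ℝ) + r) * (x + r + 1)) := by positivity
  push_cast
  nlinarith

/-- A quantity that starts at `g 0` when the first vertex of a group is added and grows at most by
the factors `(1 + attachRate α k) ^ p`. -/
lemma le_of_succ_le_attachRate (hα0 : 0 < α) (hα1 : α < 1) (hm : 1 ≤ m) {g : ℕ → ℝ} {c : ℝ}
    (p : ℕ) (hc : 0 ≤ c) (h0 : g (i * m) ≤ c)
    (hs : ∀ k, g (k + 1) ≤ (1 + attachRate α k) ^ p * g k) :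
    (∀ k, i * m ≤ k → k ≤ (i + 1) * m → g k ≤ c * ((1 + α / (1 - α)) ^ p) ^ m) ∧
    ∀ k, (i + 1) * m ≤ k → g k ≤ c * ((1 + α / (1 - α)) ^ p) ^ m *
      (((k : ℝ) / ((i + 1) * m : ℕ)) ^ α) ^ p := by
  have hΛ : 0 ≤ α / (1 - α) := div_nonneg hα0.le (by linarith)
  have h1 : ∀ l, g (i * m + l) ≤ c * ((1 + α / (1 - α)) ^ p) ^ l := by
    intro l
    induction l with
    | zero => simpa using h0
    | succ l ih =>
      have hle : attachRate α (i * m + l) ≤ α / (1 - α) := by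
        refine (attachRate_le hα0 hα1 (Nat.zero_le _)).trans_eq ?_
        simp
      have hp := attachRate_pos hα0 hα1 (i * m + l)
      calc g (i * m + l + 1) ≤ (1 + attachRate α (i * m + l)) ^ p * g (i * m + l) := hs _
        _ ≤ (1 + attachRate α (i * m + l)) ^ p * (c * ((1 + α / (1 - α)) ^ p) ^ l) := by gcongr
        _ ≤ (1 + α / (1 - α)) ^ p * (c * ((1 + α / (1 - α)) ^ p) ^ l) := by gcongr
        _ = _ := by ring
  have h2 : ∀ k, i * m ≤ k → k ≤ (i + 1) * m → g k ≤ c * ((1 + α / (1 - α)) ^ p) ^ m := by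
    intro k hk hk'
    obtain ⟨l, rfl⟩ := Nat.exists_eq_add_of_le hk
    refine (h1 l).trans ?_
    rw [add_mul] at hk'
    have : l ≤ m := by omega
    have : 1 ≤ (1 + α / (1 - α)) ^ p := one_le_pow₀ (by linarith)
    gcongr
  refine ⟨h2, fun k hk => ?_⟩
  have hk0 : 1 ≤ (i + 1) * m := Nat.mul_pos (by omega) hm
  have h3 : g k ≤ c * ((1 + α / (1 - α)) ^ p) ^ m * growth α ((i + 1) * m) k ^ p := by
    induction k, hk using Nat.le_induction with
    | base =>
      rw [growth_self, one_pow, mul_one]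
      exact h2 _ (by rw [add_mul]; omega) le_rfl
    | succ k hk ih =>
      have hp := attachRate_pos hα0 hα1 k
      rw [growth_succ hk, mul_pow]
      calc g (k + 1) ≤ (1 + attachRate α k) ^ p * g k := hs _
        _ ≤ (1 + attachRate α k) ^ p *
            (c * ((1 + α / (1 - α)) ^ p) ^ m * growth α ((i + 1) * m) k ^ p) := by gcongr
        _ = _ := by ring
  refine h3.trans ?_
  have h4 := growth_le hα0 hα1 hk0 hk
  have h5 := one_le_growth hα0 hα1 ((i + 1) * m) k
  gcongr

end chain

/-! ### Comparison of the chain with the semigroup -/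

section comparison

variable {ε α r : ℝ} {m i : ℕ}

/-- The mean in-degree of a group at the time of its completion is of order `1 / (i + 1)`. -/
lemma exists_groupExp_cast_le (hε : -1 < ε) (hα : α * (2 + ε) = 1) (hα0 : 0 < α) (hα1 : α < 1)
    (hm : 1 ≤ m) (hr : r = m * (1 + ε)) (hr0 : 0 < r) :
    ∃ D : ℝ, ∀ i : ℕ, groupExp ε hε m i ((i + 1) * m) (fun x => (x : ℝ)) ≤ D / (i + 1) := by
  set A := r * ((1 + α / (1 - α)) ^ 1) ^ m with hA
  have hΛ : 0 ≤ α / (1 - α) := div_nonneg hα0.le (by linarith)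
  have hA0 : 0 ≤ A := by positivity
  refine ⟨m * (α / (1 - α) * A), fun i => ?_⟩
  have hw := (le_of_succ_le_attachRate (i := i) hα0 hα1 hm
    (g := fun k => groupExp ε hε m i k fun x => (x : ℝ) + r) 1 hr0.le
    (by rw [groupExp_of_le hε le_rfl]; simp)
    (fun k => by rw [pow_one]; exact groupExp_weight_succ_le hε hα hα0 hα1 hm hr k)).1
  have hi : (0 : ℝ) < (i : ℝ) + 1 := by positivity
  have h : ∀ l ≤ m, groupExp ε hε m i (i * m + l) (fun x => (x : ℝ)) ≤
      l * (α / (1 - α) / (i + 1) * A) := by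
    intro l
    induction l with
    | zero =>
      intro _
      rw [add_zero, groupExp_of_le hε le_rfl]
      simp
    | succ l ih =>
      intro hl
      have h1 := groupExp_succ_le (i := i) hε hα hα0 hα1 hm hr (i * m + l)
        (h := fun x => (x : ℝ)) fun x => by push_cast; linarith
      have h2 := hw (i * m + l) (by omega) (by rw [add_mul]; omega)
      have h3 := ih (by omega)
      have e : (fun x : ℕ => (x : ℝ) + attachRate α (i * m + l) *
          ((x + r) * (((x + 1 : ℕ) : ℝ) - x))) =
          fun x : ℕ => (x : ℝ) + attachRate α (i * m + l) * (x + r) := by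
        funext x
        push_cast
        ring
      rw [e, groupExp_add, groupExp_const_mul] at h1
      have h4 := attachRate_le hα0 hα1 (show i ≤ i * m + l by nlinarith)
      have h5 := attachRate_pos hα0 hα1 (i * m + l)
      have h6 : attachRate α (i * m + l) * groupExp ε hε m i (i * m + l) (fun x => (x : ℝ) + r) ≤
          α / (1 - α) / (i + 1) * A :=
        (mul_le_mul_of_nonneg_left h2 h5.le).trans (mul_le_mul_of_nonneg_right h4 hA0)
      rw [← add_assoc]
      push_cast
      linarith
  have h' := h m le_rfl
  rw [show i * m + m = (i + 1) * m by ring] at h'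
  refine h'.trans_eq ?_
  field_simp

/-- The expectation of `f` after a total growth by the factor `z`, as a function of the current
in-degree `x` of a complete group. -/
def nbValue (f : ℕ → ℝ) (r z : ℝ) (x : ℕ) : ℝ := nbExp (fun k => f (x + k)) (x + r) z

/-- The cost of replacing a single step of the chain by the semigroup. -/
lemma abs_groupExp_nbValue_succ_sub_le (hε : -1 < ε) (hα : α * (2 + ε) = 1) (hα0 : 0 < α)
    (hα1 : α < 1) (hm : 1 ≤ m) (hr : r = m * (1 + ε)) (hr0 : 0 < r) {f : ℕ → ℝ}
    (hf : ∀ k, f k ∈ Set.Icc (0 : ℝ) 1) {j N : ℕ} (hj : (i + 1) * m ≤ j) (hjN : j < N)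
    {M : ℕ → ℝ} (hM : ∀ (x : ℕ) (w : ℝ), growth α (j + 1) N ≤ w →
      ((x : ℝ) + r) * (x + r + 1) * |nbSecondDiff (fun k => f (x + k)) (x + r) w| ≤ M x) :
    |groupExp ε hε m i (j + 1) (nbValue f r (growth α (j + 1) N)) -
      groupExp ε hε m i j (nbValue f r (growth α j N))| ≤
      attachRate α j ^ 2 * groupExp ε hε m i j M := by
  rw [groupExp_succ_of_le hε hα hm hr hj, ← groupExp_const_mul, growth_eq_mul hjN]
  refine abs_groupExp_sub_le hε j fun x => ?_
  rw [abs_sub_comm]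
  have ha : 0 < (x : ℝ) + r := by positivity
  have h := abs_nbExp_mul_one_add_sub_le ha (one_le_growth hα0 hα1 (j + 1) N)
    (attachRate_pos hα0 hα1 j).le (f := fun k => f (x + k))
    (fun k => abs_le_one_of_mem_Icc hf _) (hM x)
  have e : nbExp (fun k => f (x + (k + 1))) (x + r + 1) (growth α (j + 1) N) =
      nbValue f r (growth α (j + 1) N) (x + 1) := by
    unfold nbValue
    congr 1
    · funext k
      congr 1
      ring
    · push_cast
      ring
  rw [e] at h
  exact h

/-- Replacing the steps of the chain by the semigroup one after the other, from the completion of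
the group on. -/
lemma exists_abs_groupExp_sub_nbExp_le (hε : -1 < ε) (hα : α * (2 + ε) = 1) (hα0 : 0 < α)
    (hα1 : α < 1) (hm : 1 ≤ m) (hr : r = m * (1 + ε)) (hr0 : 0 < r) :
    ∃ C : ℝ, ∀ (i N : ℕ), (i + 1) * m ≤ N → ∀ f : ℕ → ℝ, (∀ k, f k ∈ Set.Icc (0 : ℝ) 1) →
      |groupExp ε hε m i N f - groupExp ε hε m i ((i + 1) * m)
        (nbValue f r (growth α ((i + 1) * m) N))| ≤ C / (i + 1) := by
  obtain ⟨C, hC0, hC⟩ := exists_sum_min_le hα0 hα1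
  have hΛ : 0 ≤ α / (1 - α) := div_nonneg hα0.le (by linarith)
  set A := r * ((1 + α / (1 - α)) ^ 1) ^ m with hA
  set B := r * (r + 1) * ((1 + α / (1 - α)) ^ 2) ^ m with hB
  have hA0 : 0 ≤ A := by positivity
  have hB0 : 0 ≤ B := by positivity
  set K := 2 * B + 6 * A * (1 + 2 / α) with hK
  have hK0 : 0 ≤ K := by positivity
  refine ⟨K * C, fun i N hN f hf => ?_⟩
  set a := (i + 1) * m with ha
  have ha1 : 1 ≤ a := Nat.mul_pos (by omega) hm
  have ha0 : (0 : ℝ) < a := by exact_mod_cast ha1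
  have hw := (le_of_succ_le_attachRate (i := i) hα0 hα1 hm
    (g := fun k => groupExp ε hε m i k fun x => (x : ℝ) + r) 1 hr0.le
    (by rw [groupExp_of_le hε le_rfl]; simp)
    (fun k => by rw [pow_one]; exact groupExp_weight_succ_le hε hα hα0 hα1 hm hr k)).2
  have hw2 := (le_of_succ_le_attachRate (i := i) hα0 hα1 hm
    (g := fun k => groupExp ε hε m i k fun x => ((x : ℝ) + r) * (x + r + 1)) 2
    (by positivity : 0 ≤ r * (r + 1)) (by rw [groupExp_of_le hε le_rfl]; simp)
    (groupExp_weight_sq_succ_le hε hα hα0 hα1 hm hr hr0)).2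
  have step : ∀ j ∈ Finset.Ico a N,
      |groupExp ε hε m i (j + 1) (nbValue f r (growth α (j + 1) N)) -
        groupExp ε hε m i j (nbValue f r (growth α j N))| ≤
      K * (1 / (j : ℝ) ^ 2 *
        min ((((j : ℝ) / a) ^ α) ^ 2) (((j : ℝ) / a) ^ α * (N / ((N : ℝ) - j)))) := by
    intro j hj
    rw [Finset.mem_Ico] at hj
    have hj0 : (0 : ℝ) < j := by exact_mod_cast ha1.trans hj.1
    have hja : (1 : ℝ) ≤ (j : ℝ) / a := by
      rw [one_le_div ha0]
      exact_mod_cast hj.1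
    have hjN : (0 : ℝ) < (N : ℝ) - j := by
      rw [sub_pos]
      exact_mod_cast hj.2
    have hN0 : (0 : ℝ) < N := by linarith
    set x := ((j : ℝ) / a) ^ α with hx
    have hx0 : 0 < x := by positivity
    set w := (N : ℝ) / ((N : ℝ) - j) with hwdef
    have hw0 : 0 < w := by positivity
    have hrate : attachRate α j ^ 2 ≤ 1 / (j : ℝ) ^ 2 := by
      have h1 := attachRate_le_inv hα0 hα1 (ha1.trans hj.1)
      have h2 := (attachRate_pos hα0 hα1 j).le
      calc attachRate α j ^ 2 ≤ (1 / (j : ℝ)) ^ 2 := by gcongr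
        _ = _ := by rw [div_pow, one_pow]
    have hg := one_le_growth hα0 hα1 (j + 1) N
    have b1 : |groupExp ε hε m i (j + 1) (nbValue f r (growth α (j + 1) N)) -
        groupExp ε hε m i j (nbValue f r (growth α j N))| ≤ 1 / (j : ℝ) ^ 2 * (K * x ^ 2) := by
      refine (abs_groupExp_nbValue_succ_sub_le hε hα hα0 hα1 hm hr hr0 hf hj.1 hj.2
        (M := fun y => 2 * (((y : ℝ) + r) * (y + r + 1))) fun y u hu => ?_).trans ?_
      · rw [mul_comm 2]
        have := abs_nbSecondDiff_le (by positivity : 0 < (y : ℝ) + r) (hg.trans hu)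
          (f := fun k => f (y + k)) fun k => hf _
        gcongr
      · rw [groupExp_const_mul]
        have h1 := hw2 j hj.1
        have h2 : 2 * groupExp ε hε m i j (fun y => ((y : ℝ) + r) * (y + r + 1)) ≤ K * x ^ 2 := by
          have : 0 ≤ 6 * A * (1 + 2 / α) * x ^ 2 := by positivity
          rw [hK, add_mul]
          linarith
        have h3 : 0 ≤ K * x ^ 2 := by positivity
        exact mul_le_mul hrate h2 (mul_nonneg zero_le_two
          (groupExp_nonneg hε j fun y => by positivity)) (by positivity)
    have b2 : |groupExp ε hε m i (j + 1) (nbValue f r (growth α (j + 1) N)) -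
        groupExp ε hε m i j (nbValue f r (growth α j N))| ≤ 1 / (j : ℝ) ^ 2 * (K * (x * w)) := by
      rcases lt_or_ge (j + 1) N with hlast | hlast
      · have hg1 : 1 < growth α (j + 1) N := by
          refine lt_of_lt_of_le ?_ (one_add_le_growth hα0 hα1 (j + 1) N)
          have : (0 : ℝ) < (N : ℝ) - ((j + 1 : ℕ) : ℝ) := by
            rw [sub_pos]
            exact_mod_cast hlast
          have : 0 < ((N : ℝ) - ((j + 1 : ℕ) : ℝ)) * (α / N) := by positivity
          linarith
        set V := growth α (j + 1) N / (growth α (j + 1) N - 1) with hV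
        have hV0 : 0 < V := div_pos (by linarith) (by linarith)
        have hVw : V ≤ (1 + 2 / α) * w := div_growth_sub_one_le hα0 hα1 hlast
        refine (abs_groupExp_nbValue_succ_sub_le hε hα hα0 hα1 hm hr hr0 hf hj.1 hj.2
          (M := fun y => 6 * V * ((y : ℝ) + r)) fun y u hu => ?_).trans ?_
        · refine (mul_abs_nbSecondDiff_le (by positivity) (hg1.trans_le hu)
            (f := fun k => f (y + k)) fun k => abs_le_one_of_mem_Icc hf _).trans ?_
          have h1 : u / (u - 1) ≤ V := by
            rw [hV, div_le_div_iff₀ (by linarith) (by linarith)]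
            linarith
          calc 6 * ((y : ℝ) + r) * (u / (u - 1)) ≤ 6 * ((y : ℝ) + r) * V := by gcongr
            _ = _ := by ring
        · rw [groupExp_const_mul]
          have h1 : groupExp ε hε m i j (fun y => (y : ℝ) + r) ≤ A * x := by
            have h := hw j hj.1
            rw [pow_one (((j : ℝ) / ((i + 1) * m : ℕ)) ^ α)] at h
            exact h
          have h0 : 0 ≤ groupExp ε hε m i j (fun y => (y : ℝ) + r) :=
            groupExp_nonneg hε j fun y => by positivity
          have h2 : 6 * V * groupExp ε hε m i j (fun y => (y : ℝ) + r) ≤ K * (x * w) := by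
            calc _ ≤ 6 * ((1 + 2 / α) * w) * (A * x) := by gcongr
              _ = 6 * A * (1 + 2 / α) * (x * w) := by ring
              _ ≤ K * (x * w) := by
                gcongr
                rw [hK]
                linarith
          exact mul_le_mul hrate h2 (by positivity) (by positivity)
      · -- In the last step there is no time left to regularize, but there `x ≤ w = N`.
        have hwN : w = N := by
          have : (N : ℝ) - j = 1 := by
            have : N = j + 1 := by omega
            rw [this]
            push_cast
            ring
          rw [hwdef, this, div_one]
        have hxw : x ≤ w := by
          rw [hwN]
          calc x ≤ ((j : ℝ) / a) ^ (1 : ℝ) := Real.rpow_le_rpow_of_exponent_le hja hα1.le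
            _ = (j : ℝ) / a := Real.rpow_one _
            _ ≤ j := div_le_self hj0.le (by exact_mod_cast ha1)
            _ ≤ N := by linarith
        refine b1.trans ?_
        rw [sq x]
        gcongr
    rcases min_choice (x ^ 2) (x * w) with h | h <;> rw [h]
    · exact b1.trans_eq (by ring)
    · exact b2.trans_eq (by ring)
  have tele : groupExp ε hε m i N f - groupExp ε hε m i a (nbValue f r (growth α a N)) =
      ∑ j ∈ Finset.Ico a N, (groupExp ε hε m i (j + 1) (nbValue f r (growth α (j + 1) N)) -
        groupExp ε hε m i j (nbValue f r (growth α j N))) := by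
    rw [Finset.sum_Ico_sub (fun j => groupExp ε hε m i j (nbValue f r (growth α j N))) hN]
    congr 2
    funext y
    rw [nbValue, growth_self, nbExp_one _ (by positivity), add_zero]
  rw [tele]
  refine (Finset.abs_sum_le_sum_abs _ _).trans ((Finset.sum_le_sum step).trans ?_)
  rw [← Finset.mul_sum, mul_div_assoc]
  refine mul_le_mul_of_nonneg_left ((hC a N ha1 hN).trans ?_) hK0
  have : (i : ℝ) + 1 ≤ a := by
    have : i + 1 ≤ a := Nat.le_mul_of_pos_right _ hm
    exact_mod_cast this
  gcongr

/-- The law of the in-degree is compared with the negative binomial law of the same mean: the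
discrepancy in the means caused by the construction of the group only changes the logarithm of the
second parameter by a quantity of order `1 / (i + 1)`. -/
lemma exists_abs_groupExp_sub_nbExp_mean_le (hε : -1 < ε) (hm : 1 ≤ m) (hr : r = m * (1 + ε)) :
    ∃ C : ℝ, ∀ (i N : ℕ), (i + 1) * m ≤ N →
      1 ≤ (groupExp ε hε m i N (fun x => (x : ℝ)) + r) / r ∧
      ∀ f : ℕ → ℝ, (∀ k, f k ∈ Set.Icc (0 : ℝ) 1) →
        |groupExp ε hε m i N f -
          nbExp f r ((groupExp ε hε m i N (fun x => (x : ℝ)) + r) / r)| ≤ C / (i + 1) := by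
  have h2 : (0 : ℝ) < 2 + ε := by linarith
  have hm0 : (0 : ℝ) < m := by exact_mod_cast hm
  have hr0 : 0 < r := by
    have : 0 < 1 + ε := by linarith
    rw [hr]
    positivity
  obtain ⟨α, hα⟩ : ∃ α : ℝ, α * (2 + ε) = 1 := ⟨1 / (2 + ε), by field_simp⟩
  have hα0 : 0 < α := by
    by_contra h
    nlinarith
  have hα1 : α < 1 := by nlinarith
  obtain ⟨C, hC⟩ := exists_abs_groupExp_sub_nbExp_le hε hα hα0 hα1 hm hr hr0
  obtain ⟨D, hD⟩ := exists_groupExp_cast_le hε hα hα0 hα1 hm hr hr0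
  refine ⟨C + 2 * D, fun i N hN => ?_⟩
  set a := (i + 1) * m with ha
  set d := groupExp ε hε m i a (fun x => (x : ℝ)) with hd
  have hd0 : 0 ≤ d := groupExp_nonneg hε a fun y => by positivity
  set z := growth α a N with hz
  have hz1 : 1 ≤ z := one_le_growth hα0 hα1 a N
  have hmean : (groupExp ε hε m i N (fun x => (x : ℝ)) + r) / r = z * (1 + d / r) := by
    have h := groupExp_weight_eq hε hα hm hr hN
    rw [groupExp_add, groupExp_add, groupExp_const, groupExp_const, ← hd, ← hz] at h
    rw [h]
    field_simp
    ring
  rw [hmean]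
  have hdr : 0 ≤ d / r := by positivity
  have hz' : z ≤ z * (1 + d / r) := by nlinarith
  refine ⟨hz1.trans hz', fun f hf => ?_⟩
  have e1 := hC i N hN f hf
  have e2 : |groupExp ε hε m i a (nbValue f r z) - nbExp f r z| ≤ d := by
    rw [← groupExp_const (m := m) (i := i) hε a (nbExp f r z)]
    refine abs_groupExp_sub_le hε a fun x => ?_
    rcases Nat.eq_zero_or_pos x with rfl | hx
    · simp [nbValue]
    · have h0 := nbExp_mem_Icc hr0 hz1 hf
      have h1 := nbExp_mem_Icc (by positivity : 0 < (x : ℝ) + r) hz1 (f := fun k => f (x + k))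
        fun k => hf _
      have h3 : (1 : ℝ) ≤ x := by exact_mod_cast hx
      rw [nbValue, abs_le]
      constructor <;> linarith [h0.1, h0.2, h1.1, h1.2]
  have e3 : |nbExp f r (z * (1 + d / r)) - nbExp f r z| ≤ d := by
    refine (abs_nbExp_sub_nbExp_le hr0 hz1 hz' hf).trans_eq ?_
    field_simp
    ring
  have e4 := hD i
  have e5 : (C + 2 * D) / ((i : ℝ) + 1) = C / (i + 1) + D / (i + 1) + D / (i + 1) := by ring
  rw [e5]
  rw [abs_le] at e1 e2 e3 ⊢
  constructor <;> linarith [e1.1, e1.2, e2.1, e2.2, e3.1, e3.2]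

end comparison

/-! ### Total variation distance -/

lemma negBinomial_real_eq {r z : ℝ} (hr : 0 < r) (hz : 1 ≤ z) (A : Set ℕ) :
    (negBinomial r (1 / z)).real A = nbExp (A.indicator 1) r z := by
  classical
  have e : ∀ k : ℕ, ENNReal.ofReal (Real.Gamma (r + k) / (k.factorial * Real.Gamma r) *
      (1 - 1 / z) ^ k * (1 / z) ^ r) * (Measure.dirac k A) =
      ENNReal.ofReal (A.indicator 1 k * nbMass r z k) := by
    intro k
    rw [Measure.dirac_apply' k (Set.to_countable A).measurableSet]
    by_cases hk : k ∈ A <;> simp [hk, nbMass, nbCoeff]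
  have hnn : ∀ k, 0 ≤ A.indicator 1 k * nbMass r z k := fun k =>
    mul_nonneg (Set.indicator_nonneg (fun _ _ => zero_le_one) k) (nbMass_nonneg hr hz k)
  rw [Measure.real, negBinomial, Measure.sum_apply _ (Set.to_countable A).measurableSet]
  simp only [Measure.smul_apply, smul_eq_mul, e]
  rw [ENNReal.tsum_toReal_eq fun k => ENNReal.ofReal_ne_top]
  exact tsum_congr fun k => ENNReal.toReal_ofReal (hnn k)

end

theorem mainTheorem3 (m : ℕ) (hm : 1 ≤ m) (δ : ℝ) (hδ : -(m : ℝ) < δ) :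
    ∃ C : ℝ, ∀ (n : ℕ) (i : Fin n),
      tvDist (inDegreeLaw m δ hδ n i)
        (negBinomial (m + δ) ((m + δ) / (meanInDegree m δ hδ n i + m + δ))) ≤
          C / ((i : ℕ) + 1) := by
  have hm0 : (0 : ℝ) < m := by exact_mod_cast hm
  have hr : (m : ℝ) + δ = m * (1 + δ / m) := by field_simp
  obtain ⟨C, hC⟩ := exists_abs_groupExp_sub_nbExp_mean_le (neg_one_lt_div_of_neg_lt hδ) hm hr
  refine ⟨C, fun n i => ciSup_le fun A => ?_⟩
  obtain ⟨h1, h2⟩ := hC i (n * m) (Nat.mul_le_mul_right m i.isLt)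
  have h := h2 (A.indicator 1) fun k => by
    by_cases hk : k ∈ A <;> simp [hk]
  rw [← integral_inDegreeLaw, ← negBinomial_real_eq (by linarith) h1, one_div_div,
    ← integral_inDegreeLaw, integral_indicator_one (Set.to_countable A).measurableSet,
    ← add_assoc] at h
  exact h
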